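/- All maps are finite. A \emph{polyhedral complex} is a collection $K$ of cycles (graphs $C_p$ with $p\ge 3$ vertices), called faces, together with their vertices and edges, such that the intersection of any two distinct faces is empty, a vertex, or an edge. It is a \emph{polyhedral map} if it is connected and, for every vertex $v$, the faces containing $v$ can be listed without repetition as $F_1,\dots,F_m$ with $m\ge 3$ so that $F_1\cap F_2,\dots,F_{m-1}\cap F_m,F_m\cap F_1$ are $m$ distinct edges through $v$; filling in the faces by discs then gives a closed connected surface, whose Euler characteristic is $\#\text{vertices}-\#\text{edges}+\#\text{faces}$. The map is \emph{semi-equivelar of type $(3^5,4)$} if the faces around each vertex are, in cyclic order, five triangles and one quadrangle. An isomorphism of maps is a bijection of the vertex sets that sends faces to faces in both directions; a map is vertex-transitive if its automorphism group is transitive on the vertices. Consider the following three collections of cycles on the vertices $0,1,\dots,9,u,v$: $K_1=\{012, 017, 045, 056, 067, 128, 158, 15u, 236, 267, 278, 34v, 369, 39u, 3uv, 45u, 49u, 49v, 78v, 89v, 0234, 17vu, 5698\}$, $K_2=\{012, 017, 045, 056, 067, 129, 17v, 189, 238, 268, 269, 34v, 389, 39u, 3uv, 45u, 47u, 47v, 568,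 5uv, 0234, 185v, 67u9\}$, $K_3=\{012, 017, 045, 056, 067, 129, 178, 19v, 238, 268, 269, 34v, 378, 37u, 3uv, 45u, 49u, 49v, 568, 5uv, 0234, 85v1, 67u9\}$. For a map $K$ and $t\ge 0$ let $G_t(K)$ be the graph on the vertices of $K$ in which two distinct vertices are adjacent if they have exactly $t$ common neighbours in the edge graph of $K$. \textbf{Theorem.} (1) $K_1,K_2,K_3$ are semi-equivelar maps of type $(3^5,4)$ of Euler characteristic $-1$. (2) Every semi-equivelar map of type $(3^5,4)$ on the surface of Euler characteristic $-1$ has exactly $12$ vertices and is isomorphic to $K_1$, $K_2$ or $K_3$. (3) $K_1,K_2,K_3$ are pairwise non-isomorphic; moreover, for $i\ne j$ there is $t\le 12$ such that $G_t(K_i)$ and $G_t(K_j)$ are not isomorphic. (4) None of $K_1,K_2,K_3$ is vertex-transitive; moreover, for each $i$ there is $t\le 12$ such that the automorphism group of the graph $G_t(K_i)$ is not transitive on the vertices. -/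

import Mathlib

/-! Finite polyhedral maps on surfaces.  A cycle (the boundary of a polygonal face) is recorded by
its finite set of edges, and a complex on the vertex type `V` by the finite collection of the cycles
that are its faces. -/

namespace SemiEquivelar

universe u v

/-- The edge set of the closed polygon `l₀ l₁ … lₚ₋₁ l₀`. -/
def polygon {V : Type u} [DecidableEq V] (l : List V) : Finset (Sym2 V) :=
  (List.zipWith (fun a b => s(a, b)) l (l.rotate 1)).toFinset

/-- `C` is the edge set of a `p`-cycle for some `p ≥ 3` (and then `p = C.card`). -/
def IsCycle {V : Type u} [DecidableEq V] (C : Finset (Sym2 V)) : Prop :=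
  ∃ l : List V, 3 ≤ l.length ∧ l.Nodup ∧ C = polygon l

/-- `x` is a vertex of the cycle `C`. -/
def OnCycle {V : Type u} (x : V) (C : Finset (Sym2 V)) : Prop :=
  ∃ e ∈ C, x ∈ e

/-- The intersection of the cycles `C` and `D` is exactly the edge `e`
(with its two end points). -/
def MeetInEdge {V : Type u} (C D : Finset (Sym2 V)) (e : Sym2 V) : Prop :=
  e ∈ C ∧ e ∈ D ∧ ∀ x, OnCycle x C → OnCycle x D → x ∈ e

/-- The intersection of the cycles `C` and `D` is exactly the vertex `x`. -/
def MeetInVertex {V : Type u} (C D : Finset (Sym2 V)) (x : V) : Prop :=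
  ∀ y, (OnCycle y C ∧ OnCycle y D) ↔ y = x

/-- The cycles `C` and `D` are disjoint. -/
def MeetEmpty {V : Type u} (C D : Finset (Sym2 V)) : Prop :=
  ∀ x, ¬ (OnCycle x C ∧ OnCycle x D)

/-- A two-dimensional polyhedral complex: a collection of cycles, any two of which meet in the empty
set, in a vertex or in an edge. -/
def IsPolyhedralComplex {V : Type u} [DecidableEq V] (K : Finset (Finset (Sym2 V))) : Prop :=
  (∀ C ∈ K, IsCycle C) ∧
  ∀ C ∈ K, ∀ D ∈ K, C ≠ D →
    MeetEmpty C D ∨ (∃ x, MeetInVertex C D x) ∨ ∃ e, MeetInEdge C D e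

/-- `F 0, …, F (m - 1)` are the faces of `K` at the vertex `x`, each listed once, in the cyclic order
around `x`: cyclically consecutive ones meet in an edge at `x`, and these `m` edges are distinct. -/
def IsRotation {V : Type u} (K : Finset (Finset (Sym2 V))) (x : V) {m : ℕ}
    (F : Fin m → Finset (Sym2 V)) : Prop :=
  Function.Injective F ∧
  (∀ C, (C ∈ K ∧ OnCycle x C) ↔ ∃ i, F i = C) ∧
  ∃ w : Fin m → V, Function.Injective w ∧
    ∀ i, MeetInEdge (F i) (F (finRotate m i)) s(x, w i)

/-- A polyhedral 2-manifold with vertex set `V`. -/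
def IsPolyhedralManifold {V : Type u} [DecidableEq V] (K : Finset (Finset (Sym2 V))) : Prop :=
  IsPolyhedralComplex K ∧
  ∀ x : V, ∃ m, 3 ≤ m ∧ ∃ F : Fin m → Finset (Sym2 V), IsRotation K x F

/-- The edge graph of `K`. -/
def edgeGraph {V : Type u} (K : Finset (Finset (Sym2 V))) : SimpleGraph V :=
  SimpleGraph.fromEdgeSet {e | ∃ C ∈ K, e ∈ C}

/-- A polyhedral map: a connected polyhedral 2-manifold (used for finite `V`).  Since every face is a
polygon with connected boundary, the carrier is connected exactly when the edge graph is. -/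
def IsPolyhedralMap {V : Type u} [DecidableEq V] (K : Finset (Finset (Sym2 V))) : Prop :=
  IsPolyhedralManifold K ∧ (edgeGraph K).Connected

/-- The Euler characteristic: number of vertices - number of edges + number of faces. -/
def eulerChar {V : Type u} [Fintype V] [DecidableEq V] (K : Finset (Finset (Sym2 V))) : ℤ :=
  (Fintype.card V : ℤ) - ((K.biUnion id).card : ℤ) + (K.card : ℤ)

/-- The faces around the vertex `x` have, in cyclic order, the numbers of sides listed in `l`. -/
def HasFaceSequence {V : Type u} (K : Finset (Finset (Sym2 V))) (x : V) (l : List ℕ) : Prop :=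
  ∃ F : Fin l.length → Finset (Sym2 V), IsRotation K x F ∧ ∀ i, (F i).card = l.get i

/-- A semi-equivelar map of type `l`; type `(3⁵, 4)` is `l = [3, 3, 3, 3, 3, 4]`. -/
def IsSemiEquivelarMap {V : Type u} [DecidableEq V] (K : Finset (Finset (Sym2 V)))
    (l : List ℕ) : Prop :=
  IsPolyhedralMap K ∧ ∀ x : V, HasFaceSequence K x l

/-- The bijection `f` of the vertex sets is an isomorphism from `K` to `L`. -/
def IsIsomorphism {V : Type u} {W : Type v} (K : Finset (Finset (Sym2 V)))
    (L : Finset (Finset (Sym2 W))) (f : V ≃ W) : Prop :=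
  ∀ C : Finset (Sym2 V), C ∈ K ↔ C.map f.toEmbedding.sym2Map ∈ L

/-- `K` and `L` are isomorphic. -/
def Isomorphic {V : Type u} {W : Type v} (K : Finset (Finset (Sym2 V)))
    (L : Finset (Finset (Sym2 W))) : Prop :=
  ∃ f : V ≃ W, IsIsomorphism K L f

/-- The automorphism group of `K` acts transitively on the vertices. -/
def IsVertexTransitive {V : Type u} (K : Finset (Finset (Sym2 V))) : Prop :=
  ∀ x y : V, ∃ f : V ≃ V, IsIsomorphism K K f ∧ f x = y

/-- The graph `G_t(K)`: two distinct vertices are adjacent if they have exactly `t` common neighbours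
in the edge graph of `K`. -/
def commonGraph {V : Type u} (K : Finset (Finset (Sym2 V))) (t : ℕ) : SimpleGraph V where
  Adj x y := x ≠ y ∧ ((edgeGraph K).neighborSet x ∩ (edgeGraph K).neighborSet y).ncard = t
  symm := ⟨fun x y h => ⟨h.1.symm, by rw [Set.inter_comm]; exact h.2⟩⟩
  loopless := ⟨fun _ h => h.1 rfl⟩

/-- The collection of polygons with the listed vertex cycles. -/
def ofLists {V : Type u} [DecidableEq V] (L : List (List V)) : Finset (Finset (Sym2 V)) :=
  (L.map polygon).toFinset

/-- The map `K₁` (with vertices `0, …, 11`). -/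
def K₁ : Finset (Finset (Sym2 (Fin 12))) := ofLists
  [[0, 1, 2], [0, 1, 7], [0, 4, 5], [0, 5, 6], [0, 6, 7], [1, 2, 8], [1, 5, 8], [1, 5, 10],
   [2, 3, 6], [2, 6, 7], [2, 7, 8], [3, 4, 11], [3, 6, 9], [3, 9, 10], [3, 10, 11], [4, 5, 10],
   [4, 9, 10], [4, 9, 11], [7, 8, 11], [8, 9, 11],
   [0, 2, 3, 4], [1, 7, 11, 10], [5, 6, 9, 8]]

/-- The map `K₂`. -/
def K₂ : Finset (Finset (Sym2 (Fin 12))) := ofLists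
  [[0, 1, 2], [0, 1, 7], [0, 4, 5], [0, 5, 6], [0, 6, 7], [1, 2, 9], [1, 7, 11], [1, 8, 9],
   [2, 3, 8], [2, 6, 8], [2, 6, 9], [3, 4, 11], [3, 8, 9], [3, 9, 10], [3, 10, 11], [4, 5, 10],
   [4, 7, 10], [4, 7, 11], [5, 6, 8], [5, 10, 11],
   [0, 2, 3, 4], [1, 8, 5, 11], [6, 7, 10, 9]]

/-- The map `K₃`. -/
def K₃ : Finset (Finset (Sym2 (Fin 12))) := ofLists
  [[0, 1, 2], [0, 1, 7], [0, 4, 5], [0, 5, 6], [0, 6, 7], [1, 2, 9], [1, 7, 8], [1, 9, 11],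
   [2, 3, 8], [2, 6, 8], [2, 6, 9], [3, 4, 11], [3, 7, 8], [3, 7, 10], [3, 10, 11], [4, 5, 10],
   [4, 9, 10], [4, 9, 11], [5, 6, 8], [5, 10, 11],
   [0, 2, 3, 4], [8, 5, 11, 1], [6, 7, 10, 9]]

/-- The three maps as a family. -/
def model : Fin 3 → Finset (Finset (Sym2 (Fin 12))) := ![K₁, K₂, K₃]

end SemiEquivelar

/-!
Let `K` be a semi-equivelar map of type `(3⁵, 4)` with `n` vertices. Every vertex lies on six edges,
five triangles and one quadrangle, so there are `3n` edges, `5n/3` triangles and `n/4` quadrangles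
and the Euler characteristic is `-n/12`. Euler characteristic `-1` therefore means `n = 12`, with
`20` triangles and with three quadrangles that partition the vertices.

The vertices can be labelled by the integers modulo `12` such that the quadrangles are
`a, a + 3, a + 6, a + 9`; only the triangles are unknown (`IsFrame`, `Labelling`). Walking around
the vertex `0` from the edge to `3`, the next vertex is on another quadrangle and is called `1`, and
the walk then follows the quadrangle through `1` for zero to three steps before it meets the last
quadrangle, or never meets it. This gives four initial configurations (`exists_frame_start`).
From each of them an exhaustive search completes the vertex links one after the other. A partial
collection of triangles is discarded only for a property that no map has: an edge on three faces,
a vertex with seven neighbours, a triangle with two opposite vertices of a quadrangle, or a cycle of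
length less than six in the link of a vertex, which is a `6`-cycle (`Labelling.exists_accept`).
Every collection that survives contains a relabelled copy of all faces of one of the models
(`searchFrom₁`, …, `searchFrom₄`), and such a copy is an isomorphism because both sides have `23`
faces (`IsFrame.isomorphic_of_embeds`).

That the models are maps of the right type is checked face by face and vertex by vertex. The graphs
`G₄` of the models have `4`, `2` and `3` vertices of degree three, out of twelve: hence they are
pairwise non-isomorphic, and none of them is vertex-transitive (`card_degree_eq_three`). Since
isomorphisms of maps induce isomorphisms of these graphs, the same holds for the models.
-/

namespace SemiEquivelar

/-! ### Polygons -/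

section Polygons

variable {V : Type*} [DecidableEq V]

theorem polygon_triangle (a b c : V) : polygon [a, b, c] = {s(a, b), s(b, c), s(c, a)} := by
  simp [polygon, List.rotate]

theorem polygon_quadrangle (a b c d : V) :
    polygon [a, b, c, d] = {s(a, b), s(b, c), s(c, d), s(d, a)} := by
  simp [polygon, List.rotate]

theorem card_polygon {l : List V} (hl : l.Nodup) (h3 : 3 ≤ l.length) :
    (polygon l).card = l.length := by
  have hlen : (List.zipWith (fun a b => s(a, b)) l (l.rotate 1)).length = l.length := by simp
  rw [polygon, List.toFinset_card_of_nodup, hlen]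
  rw [List.nodup_iff_injective_get]
  rintro ⟨i, hi⟩ ⟨j, hj⟩ hij
  rw [hlen] at hi hj
  simp only [List.get_eq_getElem, List.getElem_zipWith, List.getElem_rotate, Sym2.eq_iff] at hij
  have inj : ∀ {m n : ℕ} (hm : m < l.length) (hn : n < l.length), l[m] = l[n] → m = n :=
    fun hm hn h => (hl.getElem_inj_iff).1 h
  have hn : 0 < l.length := by omega
  rcases hij with ⟨h, -⟩ | ⟨h₁, h₂⟩
  · simpa using inj hi hj h
  · have e₁ := inj hi (Nat.mod_lt _ hn) h₁
    have e₂ := inj (Nat.mod_lt _ hn) hj h₂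
    exfalso
    -- The two edges would have to be successors of each other modulo the length, which is at least 3.
    have key : ∀ k, k < l.length →
        (k + 1) % l.length = k + 1 ∨ (k + 1 = l.length ∧ (k + 1) % l.length = 0) := by
      intro k hk
      rcases Nat.lt_or_ge (k + 1) l.length with h | h
      · exact Or.inl (Nat.mod_eq_of_lt h)
      · have : k + 1 = l.length := by omega
        exact Or.inr ⟨this, by rw [this, Nat.mod_self]⟩
    rcases key i hi with h | h <;> rcases key j hj with h' | h' <;> omega

theorem onCycle_polygon {x : V} {l : List V} (h2 : l ≠ []) : OnCycle x (polygon l) ↔ x ∈ l := by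
  have hn : 0 < l.length := List.length_pos_iff.2 h2
  simp only [OnCycle, polygon, List.mem_toFinset]
  constructor
  · rintro ⟨e, he, hx⟩
    obtain ⟨i, hi, rfl⟩ := List.getElem_of_mem he
    simp only [List.getElem_zipWith, List.getElem_rotate, Sym2.mem_iff] at hx
    rcases hx with rfl | rfl <;> exact List.getElem_mem _
  · intro hx
    obtain ⟨i, hi, rfl⟩ := List.getElem_of_mem hx
    have hi' : i < (List.zipWith (fun a b => s(a, b)) l (l.rotate 1)).length := by simpa using hi
    exact ⟨_, List.getElem_mem hi', by simp⟩

theorem IsCycle.exists_triangle {C : Finset (Sym2 V)} (h : IsCycle C) (hc : C.card = 3) :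
    ∃ a b c, [a, b, c].Nodup ∧ C = polygon [a, b, c] := by
  obtain ⟨l, h3, hl, rfl⟩ := h
  rw [card_polygon hl h3] at hc
  match l, hc with
  | [a, b, c], _ => exact ⟨a, b, c, hl, rfl⟩

theorem IsCycle.exists_quadrangle {C : Finset (Sym2 V)} (h : IsCycle C) (hc : C.card = 4) :
    ∃ a b c d, [a, b, c, d].Nodup ∧ C = polygon [a, b, c, d] := by
  obtain ⟨l, h3, hl, rfl⟩ := h
  rw [card_polygon hl h3] at hc
  match l, hc with
  | [a, b, c, d], _ => exact ⟨a, b, c, d, hl, rfl⟩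

end Polygons

/-! ### Triangles and quadrangles of a complex -/

section Faces

variable {V : Type*} [DecidableEq V]

/-- `abc` is a triangular face of `K`. -/
def Tri (K : Finset (Finset (Sym2 V))) (a b c : V) : Prop :=
  [a, b, c].Nodup ∧ polygon [a, b, c] ∈ K

/-- `abcd` is a quadrangular face of `K`. -/
def Quad (K : Finset (Finset (Sym2 V))) (a b c d : V) : Prop :=
  [a, b, c, d].Nodup ∧ polygon [a, b, c, d] ∈ K

variable {K : Finset (Finset (Sym2 V))} {a b c d : V}

theorem Tri.swap_left (h : Tri K a b c) : Tri K b a c := by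
  obtain ⟨h₁, h₂⟩ := h
  refine ⟨by simp at h₁ ⊢; tauto, ?_⟩
  convert h₂ using 1
  rw [polygon_triangle, polygon_triangle]
  ext e; simp [Sym2.eq_swap]; tauto

theorem Tri.swap_right (h : Tri K a b c) : Tri K a c b := by
  obtain ⟨h₁, h₂⟩ := h
  refine ⟨by simp at h₁ ⊢; tauto, ?_⟩
  convert h₂ using 1
  rw [polygon_triangle, polygon_triangle]
  ext e; simp [Sym2.eq_swap]; tauto

theorem Quad.rotate (h : Quad K a b c d) : Quad K b c d a := by
  obtain ⟨h₁, h₂⟩ := h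
  refine ⟨by simp at h₁ ⊢; tauto, ?_⟩
  convert h₂ using 1
  rw [polygon_quadrangle, polygon_quadrangle]
  ext e; simp; tauto

theorem Quad.reflect (h : Quad K a b c d) : Quad K a d c b := by
  obtain ⟨h₁, h₂⟩ := h
  refine ⟨by simp at h₁ ⊢; tauto, ?_⟩
  convert h₂ using 1
  rw [polygon_quadrangle, polygon_quadrangle]
  ext e; simp [Sym2.eq_swap]; tauto

/-- If `C` is a triangle with edges `xy` and `xz`, then `C` is `xyz`. -/
theorem eq_triangle_of_mem {C : Finset (Sym2 V)} (hC : IsCycle C) (h3 : C.card = 3) {x y z : V}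
    (hyz : y ≠ z) (hy : s(x, y) ∈ C) (hz : s(x, z) ∈ C) :
    [x, y, z].Nodup ∧ C = polygon [x, y, z] := by
  obtain ⟨a, b, c, hl, rfl⟩ := hC.exists_triangle h3
  have h₀ := hl
  rw [polygon_triangle] at hy hz ⊢
  rw [polygon_triangle]
  simp only [Finset.mem_insert, Finset.mem_singleton, Sym2.eq_iff] at hy hz
  simp only [List.nodup_cons, List.mem_cons, List.not_mem_nil, or_false, not_or, not_false_eq_true,
    List.nodup_nil, and_true] at hl ⊢
  obtain ⟨⟨hab, hac⟩, hbc⟩ := hl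
  constructor
  · grind
  · ext e
    simp only [Finset.mem_insert, Finset.mem_singleton]
    rcases hy with (⟨rfl, rfl⟩ | ⟨rfl, rfl⟩) | (⟨rfl, rfl⟩ | ⟨rfl, rfl⟩) | ⟨rfl, rfl⟩ | ⟨rfl, rfl⟩ <;>
    rcases hz with (⟨hz, hz'⟩ | ⟨hz, hz'⟩) | (⟨hz, hz'⟩ | ⟨hz, hz'⟩) | ⟨hz, hz'⟩ | ⟨hz, hz'⟩ <;>
    first
    | (exfalso; grind)
    | (subst hz'; simp [Sym2.eq_swap]; try tauto)

/-- If `C` is a quadrangle with edges `xy` and `xz`, then `C` is `xydz` for some `d`. -/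
theorem eq_quadrangle_of_mem {C : Finset (Sym2 V)} (hC : IsCycle C) (h4 : C.card = 4) {x y z : V}
    (hyz : y ≠ z) (hy : s(x, y) ∈ C) (hz : s(x, z) ∈ C) :
    ∃ d, [x, y, d, z].Nodup ∧ C = polygon [x, y, d, z] := by
  obtain ⟨a, b, c, d, hl, rfl⟩ := hC.exists_quadrangle h4
  have hne : a ≠ b ∧ a ≠ c ∧ a ≠ d ∧ b ≠ c ∧ b ≠ d ∧ c ≠ d := by simp at hl; tauto
  have hq : Quad {polygon [a, b, c, d]} a b c d := ⟨hl, by simp⟩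
  rw [polygon_quadrangle] at hy hz
  simp only [Finset.mem_insert, Finset.mem_singleton, Sym2.eq_iff] at hy hz
  suffices ∃ e, Quad {polygon [a, b, c, d]} x y e z by
    obtain ⟨e, h₁, h₂⟩ := this
    exact ⟨e, h₁, (Finset.mem_singleton.1 h₂).symm⟩
  generalize ({polygon [a, b, c, d]} : Finset (Finset (Sym2 V))) = K at hq
  -- Every corner of the quadrangle, in either direction, is the first vertex of one of the eight
  -- rotations and reflections of `abcd`.
  have r₁ := hq.rotate
  have r₂ := r₁.rotate
  have r₃ := r₂.rotate
  have hz' : z = a ∨ z = b ∨ z = c ∨ z = d := by grind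
  rcases hy with (⟨rfl, rfl⟩ | ⟨rfl, rfl⟩) | (⟨rfl, rfl⟩ | ⟨rfl, rfl⟩) |
    (⟨rfl, rfl⟩ | ⟨rfl, rfl⟩) | ⟨rfl, rfl⟩ | ⟨rfl, rfl⟩
  all_goals
    rcases hz' with rfl | rfl | rfl | rfl
    all_goals
      first
      | exact ⟨_, hq⟩ | exact ⟨_, r₁⟩ | exact ⟨_, r₂⟩ | exact ⟨_, r₃⟩ | exact ⟨_, hq.reflect⟩
      | exact ⟨_, r₁.reflect⟩ | exact ⟨_, r₂.reflect⟩ | exact ⟨_, r₃.reflect⟩ | (exfalso; grind)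

end Faces

/-! ### The faces around a vertex -/

section Star

variable {V : Type*} [DecidableEq V] {K : Finset (Finset (Sym2 V))} {x y z d e : V} {w : Fin 6 → V}

/-- The faces at `x` are, in cyclic order, the triangles `x w₀ w₁, …, x w₄ w₅` and the
quadrangle `x w₅ d w₀`. -/
structure Star (K : Finset (Finset (Sym2 V))) (x : V) (w : Fin 6 → V) (d : V) : Prop where
  injective : Function.Injective w
  tri : ∀ i, i ≠ 5 → Tri K x (w i) (w (i + 1))
  quad : Quad K x (w 5) d (w 0)
  opposite_ne : ∀ i, d ≠ w i
  complete : ∀ C ∈ K, OnCycle x C →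
    C = polygon [x, w 5, d, w 0] ∨ ∃ i, i ≠ 5 ∧ C = polygon [x, w i, w (i + 1)]

/-- Around `x`, the edges `xy` and `xz` are consecutive: they are distinct edges of a common
triangle or quadrangle. -/
def Link (K : Finset (Finset (Sym2 V))) (x y z : V) : Prop :=
  Tri K x y z ∨ ∃ d, Quad K x y d z

/-- No other face contains both ends `x`, `d` of a diagonal of a quadrangle, since two faces that
share two vertices share the edge between them. -/
theorem IsPolyhedralComplex.opposite_notMem (hK : IsPolyhedralComplex K) {C : Finset (Sym2 V)}
    (hC : C ∈ K) (hq : Quad K x y d z) (hne : C ≠ polygon [x, y, d, z]) (hx : OnCycle x C) :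
    ¬ OnCycle d C := by
  intro hd
  have hn := hq.1
  simp only [List.nodup_cons, List.mem_cons, List.not_mem_nil, or_false, not_or] at hn
  have hxq : OnCycle x (polygon [x, y, d, z]) := (onCycle_polygon (by simp)).2 (by simp)
  have hdq : OnCycle d (polygon [x, y, d, z]) := (onCycle_polygon (by simp)).2 (by simp)
  rcases hK.2 C hC _ hq.2 hne with h | ⟨u, h⟩ | ⟨f, -, hf, h⟩
  · exact h x ⟨hx, hxq⟩
  · exact hn.1.2.1 (((h x).1 ⟨hx, hxq⟩).trans ((h d).1 ⟨hd, hdq⟩).symm)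
  · have hfe : f = s(x, d) := (Sym2.mem_and_mem_iff hn.1.2.1).1 ⟨h x hx hxq, h d hd hdq⟩
    subst hfe
    rw [polygon_quadrangle] at hf
    simp only [Finset.mem_insert, Finset.mem_singleton, Sym2.eq_iff] at hf
    grind

theorem exists_star (hK : IsPolyhedralComplex K) (h : HasFaceSequence K x [3, 3, 3, 3, 3, 4]) :
    ∃ w d, Star K x w d := by
  obtain ⟨F, ⟨hF, hcomp, u, hu, hmeet⟩, hcard⟩ := h
  change Fin 6 → Finset (Sym2 V) at F
  change Fin 6 → V at u
  -- In `IsRotation` the edge `i` is shared by the faces `i` and `i + 1`; a `Star` is indexed such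
  -- that the face `i` has the edges `i` and `i + 1`, whence the shift by one below.
  have hmeet' : ∀ i : Fin 6, MeetInEdge (F i) (F (i + 1)) s(x, u i) := fun i => by
    simpa [finRotate_apply] using hmeet i
  have h₁ : ∀ i : Fin 6, i - 1 + 1 = i := by decide
  have h₂ : ∀ i : Fin 6, i + 1 - 1 = i := by decide
  have hFK : ∀ i, F i ∈ K ∧ OnCycle x (F i) := fun i => (hcomp _).2 ⟨i, rfl⟩
  have hcyc : ∀ i, IsCycle (F i) := fun i => hK.1 _ (hFK i).1
  have hl : ∀ i : Fin 6, s(x, u (i - 1)) ∈ F i := fun i => by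
    simpa only [h₁] using (hmeet' (i - 1)).2.1
  have hr : ∀ i : Fin 6, s(x, u (i + 1 - 1)) ∈ F i := fun i => by
    simpa only [h₂] using (hmeet' i).1
  have hne : ∀ i : Fin 6, u (i - 1) ≠ u (i + 1 - 1) := fun i hi =>
    absurd (hu hi) (by clear hi; revert i; decide)
  have hc3 : ∀ i : Fin 6, i ≠ 5 → (F i).card = 3 := by
    intro i hi
    refine (hcard i).trans ?_
    revert i; decide
  have hc4 : (F 5).card = 4 := hcard (5 : Fin 6)
  have htri : ∀ i : Fin 6, i ≠ 5 →
      [x, u (i - 1), u (i + 1 - 1)].Nodup ∧ F i = polygon [x, u (i - 1), u (i + 1 - 1)] :=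
    fun i hi => eq_triangle_of_mem (hcyc i) (hc3 i hi) (hne i) (hl i) (hr i)
  obtain ⟨d, hd, hF5⟩ := eq_quadrangle_of_mem (hcyc 5) hc4 (hne 5) (hl 5) (hr 5)
  have hq : Quad K x (u (5 - 1)) d (u (0 - 1)) := ⟨hd, hF5 ▸ (hFK 5).1⟩
  refine ⟨fun i => u (i - 1), d, ?_, ?_, hq, ?_, ?_⟩
  · intro i j hij
    have := hu hij
    rw [← h₁ i, ← h₁ j, this]
  · exact fun i hi => ⟨(htri i hi).1, (htri i hi).2 ▸ (hFK i).1⟩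
  · intro i hdi
    obtain ⟨j, hj, hji⟩ : ∃ j : Fin 6, j ≠ 5 ∧ (i = j ∨ i = j + 1) := by
      clear hdi; revert i; decide
    refine hK.opposite_notMem (hFK j).1 hq ?_ (hFK j).2 ?_
    · exact fun h => hj (hF (h.trans hF5.symm))
    · rw [(htri j hj).2, onCycle_polygon (by simp), hdi]
      rcases hji with rfl | rfl <;> simp
  · intro C hC hxC
    obtain ⟨i, rfl⟩ := (hcomp C).1 ⟨hC, hxC⟩
    by_cases hi : i = 5
    · subst hi; exact Or.inl hF5
    · exact Or.inr ⟨i, hi, (htri i hi).2⟩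

theorem Tri.link (h : Tri K x y z) : Link K x y z := Or.inl h

theorem Quad.link (h : Quad K x y d z) : Link K x y z := Or.inr ⟨d, h⟩

theorem Link.symm (h : Link K x y z) : Link K x z y := by
  rcases h with h | ⟨d, h⟩
  · exact h.swap_right.link
  · exact h.reflect.link

theorem Star.quad_unique (hs : Star K x w d) (h : Quad K x y e z) :
    e = d ∧ (y = w 5 ∧ z = w 0 ∨ y = w 0 ∧ z = w 5) := by
  have hx : OnCycle x (polygon [x, y, e, z]) := (onCycle_polygon (by simp)).2 (by simp)
  have hn := h.1
  have hn' := hs.quad.1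
  rcases hs.complete _ h.2 hx with hC | ⟨i, hi, hC⟩
  · have hy : s(x, y) ∈ polygon [x, w 5, d, w 0] := by rw [← hC, polygon_quadrangle]; simp
    have hz : s(x, z) ∈ polygon [x, w 5, d, w 0] := by
      rw [← hC, polygon_quadrangle]; simp [Sym2.eq_swap]
    have he : OnCycle e (polygon [x, w 5, d, w 0]) := by rw [← hC, onCycle_polygon] <;> simp
    rw [onCycle_polygon (by simp)] at he
    rw [polygon_quadrangle] at hy hz
    simp only [List.nodup_cons, List.mem_cons, List.not_mem_nil, or_false, not_or,
      Finset.mem_insert, Finset.mem_singleton, Sym2.eq_iff] at *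
    grind
  · have := congrArg Finset.card hC
    rw [card_polygon hn (by simp), card_polygon (hs.tri i hi).1 (by simp)] at this
    simp at this

/-- The relation `Link K x` is the adjacency of a `6`-cycle. -/
theorem Star.link_iff (hs : Star K x w d) : Link K x y z ↔
    ∃ i, y = w i ∧ z = w (i + 1) ∨ z = w i ∧ y = w (i + 1) := by
  constructor
  · rintro (h | ⟨e, h⟩)
    · have hx : OnCycle x (polygon [x, y, z]) := (onCycle_polygon (by simp)).2 (by simp)
      have hn := h.1
      rcases hs.complete _ h.2 hx with hC | ⟨i, hi, hC⟩
      · have := congrArg Finset.card hC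
        rw [card_polygon hn (by simp), card_polygon hs.quad.1 (by simp)] at this
        simp at this
      · refine ⟨i, ?_⟩
        have hn' := (hs.tri i hi).1
        have hy : OnCycle y (polygon [x, w i, w (i + 1)]) := by
          rw [← hC, onCycle_polygon] <;> simp
        have hz : OnCycle z (polygon [x, w i, w (i + 1)]) := by
          rw [← hC, onCycle_polygon] <;> simp
        rw [onCycle_polygon (by simp)] at hy hz
        simp only [List.nodup_cons, List.mem_cons, List.not_mem_nil, or_false, not_or] at *
        grind
    · obtain ⟨-, h | h⟩ := hs.quad_unique h
      · exact ⟨5, Or.inl h⟩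
      · exact ⟨5, Or.inr h.symm⟩
  · have key : ∀ i, Link K x (w i) (w (i + 1)) := by
      intro i
      by_cases hi : i = 5
      · subst hi; exact hs.quad.link
      · exact (hs.tri i hi).link
    rintro ⟨i, ⟨rfl, rfl⟩ | ⟨rfl, rfl⟩⟩
    · exact key i
    · exact (key i).symm

theorem Star.opposite_not_link (hs : Star K x w d) (h : Quad K x y e z) (f : V) :
    ¬ Link K x e f := by
  intro hl
  obtain ⟨i, h' | h'⟩ := hs.link_iff.1 hl
  · exact hs.opposite_ne i ((hs.quad_unique h).1.symm.trans h'.1)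
  · exact hs.opposite_ne _ ((hs.quad_unique h).1.symm.trans h'.2)

end Star

/-! ### Counting faces and edges -/

section Counting

variable {V : Type*} [DecidableEq V] {K : Finset (Finset (Sym2 V))} {x y d : V} {w : Fin 6 → V}

theorem Star.ne (hs : Star K x w d) (i : Fin 6) : x ≠ w i := by
  by_cases hi : i = 5
  · subst hi
    have := hs.quad.1
    simp at this; tauto
  · have := (hs.tri i hi).1
    simp at this; tauto

theorem Star.edge_mem (hs : Star K x w d) (i : Fin 6) : ∃ C ∈ K, s(x, w i) ∈ C := by
  by_cases hi : i = 5
  · subst hi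
    exact ⟨_, hs.quad.2, by simp [polygon_quadrangle]⟩
  · exact ⟨_, (hs.tri i hi).2, by simp [polygon_triangle]⟩

theorem Star.exists_of_edge (hs : Star K x w d) {C : Finset (Sym2 V)} (hC : C ∈ K)
    (hy : s(x, y) ∈ C) : ∃ i, y = w i := by
  have hne := hs.ne
  have hd : x ≠ d := by have := hs.quad.1; simp at this; tauto
  rcases hs.complete C hC ⟨_, hy, by simp⟩ with rfl | ⟨i, -, rfl⟩
  · rw [polygon_quadrangle] at hy
    simp only [Finset.mem_insert, Finset.mem_singleton, Sym2.eq_iff] at hy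
    grind
  · rw [polygon_triangle] at hy
    simp only [Finset.mem_insert, Finset.mem_singleton, Sym2.eq_iff] at hy
    grind

theorem Star.triangle_injective (hs : Star K x w d) {i j : Fin 6}
    (h : polygon [x, w i, w (i + 1)] = polygon [x, w j, w (j + 1)]) : i = j := by
  have key : ∀ {i j : Fin 6}, polygon [x, w i, w (i + 1)] = polygon [x, w j, w (j + 1)] →
      i = j ∨ i = j + 1 := by
    intro i j h
    have hm : OnCycle (w i) (polygon [x, w j, w (j + 1)]) := by
      rw [← h, onCycle_polygon] <;> simp
    rw [onCycle_polygon (by simp)] at hm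
    simp only [List.mem_cons, List.not_mem_nil, or_false, (hs.ne i).symm, false_or,
      hs.injective.eq_iff] at hm
    exact hm
  have h₁ := key h
  have h₂ := key h.symm
  clear h
  revert i j
  decide

theorem Star.card_triangles (hs : Star K x w d) [DecidablePred (OnCycle x)] :
    ({C ∈ K | C.card = 3} |>.filter (OnCycle x)).card = 5 := by
  have : ({C ∈ K | C.card = 3} |>.filter (OnCycle x)) =
      ({i : Fin 6 | i ≠ 5} : Finset (Fin 6)).image fun i => polygon [x, w i, w (i + 1)] := by
    ext C
    simp only [Finset.mem_filter, Finset.mem_image, Finset.mem_univ, true_and]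
    constructor
    · rintro ⟨⟨hC, h3⟩, hx⟩
      rcases hs.complete C hC hx with rfl | ⟨i, hi, rfl⟩
      · rw [card_polygon hs.quad.1 (by simp)] at h3
        simp at h3
      · exact ⟨i, hi, rfl⟩
    · rintro ⟨i, hi, rfl⟩
      exact ⟨⟨(hs.tri i hi).2, card_polygon (hs.tri i hi).1 (by simp)⟩,
        (onCycle_polygon (by simp)).2 (by simp)⟩
  rw [this, Finset.card_image_of_injective _ fun i j h => hs.triangle_injective h]
  decide

theorem Star.card_quadrangles (hs : Star K x w d) [DecidablePred (OnCycle x)] :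
    ({C ∈ K | C.card = 4} |>.filter (OnCycle x)).card = 1 := by
  rw [Finset.card_eq_one]
  refine ⟨polygon [x, w 5, d, w 0], ?_⟩
  ext C
  simp only [Finset.mem_filter, Finset.mem_singleton]
  constructor
  · rintro ⟨⟨hC, h4⟩, hx⟩
    rcases hs.complete C hC hx with rfl | ⟨i, hi, rfl⟩
    · rfl
    · rw [card_polygon (hs.tri i hi).1 (by simp)] at h4
      simp at h4
  · rintro rfl
    exact ⟨⟨hs.quad.2, card_polygon hs.quad.1 (by simp)⟩, (onCycle_polygon (by simp)).2 (by simp)⟩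

theorem Star.card_edges (hs : Star K x w d) [DecidablePred fun e : Sym2 V => x ∈ e] :
    ((K.biUnion id).filter fun e => x ∈ e).card = 6 := by
  have : ((K.biUnion id).filter fun e => x ∈ e) = Finset.univ.image fun i => s(x, w i) := by
    ext e
    simp only [Finset.mem_filter, Finset.mem_biUnion, id, Finset.mem_image, Finset.mem_univ,
      true_and]
    constructor
    · rintro ⟨⟨C, hC, he⟩, y, rfl⟩
      obtain ⟨i, rfl⟩ := hs.exists_of_edge hC he
      exact ⟨i, rfl⟩
    · rintro ⟨i, rfl⟩
      exact ⟨hs.edge_mem i, by simp⟩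
  rw [this, Finset.card_image_of_injective]
  · rfl
  · intro i j hij
    exact hs.injective (Sym2.congr_right.1 hij)

theorem IsSemiEquivelarMap.exists_star (hK : IsSemiEquivelarMap K [3, 3, 3, 3, 3, 4]) (x : V) :
    ∃ w d, Star K x w d :=
  SemiEquivelar.exists_star hK.1.1.1 (hK.2 x)

variable [Fintype V]

theorem card_onCycle_polygon {l : List V} (hl : l.Nodup) (hne : l ≠ [])
    [DecidablePred fun x => OnCycle x (polygon l)] :
    ({x | OnCycle x (polygon l)} : Finset V).card = l.length := by
  have : ({x | OnCycle x (polygon l)} : Finset V) = l.toFinset := by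
    ext x; simp [onCycle_polygon hne]
  rw [this, List.toFinset_card_of_nodup hl]

/-- A semi-equivelar map of type `(3⁵, 4)` with `n` vertices has `5n/3` triangles, `n/4` quadrangles
and `3n` edges. -/
theorem IsSemiEquivelarMap.card_faces_edges (hK : IsSemiEquivelarMap K [3, 3, 3, 3, 3, 4]) :
    K.card * 12 = Fintype.card V * 23 ∧ (K.biUnion id).card * 2 = Fintype.card V * 6 := by
  classical
  have h3 : ({C ∈ K | C.card = 3}).card * 3 = Fintype.card V * 5 := by
    refine Finset.card_mul_eq_card_mul (fun C x => OnCycle x C) ?_ ?_ (t := Finset.univ)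
    · intro C hC
      obtain ⟨hC, hc⟩ := Finset.mem_filter.1 hC
      obtain ⟨a, b, c, hl, rfl⟩ := (hK.1.1.1.1 C hC).exists_triangle hc
      exact card_onCycle_polygon hl (by simp)
    · intro x _
      obtain ⟨w, d, hs⟩ := hK.exists_star x
      exact hs.card_triangles
  have h4 : ({C ∈ K | C.card = 4}).card * 4 = Fintype.card V * 1 := by
    refine Finset.card_mul_eq_card_mul (fun C x => OnCycle x C) ?_ ?_ (t := Finset.univ)
    · intro C hC
      obtain ⟨hC, hc⟩ := Finset.mem_filter.1 hC
      obtain ⟨a, b, c, d, hl, rfl⟩ := (hK.1.1.1.1 C hC).exists_quadrangle hc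
      exact card_onCycle_polygon hl (by simp)
    · intro x _
      obtain ⟨w, d, hs⟩ := hK.exists_star x
      exact hs.card_quadrangles
  have h2 : (K.biUnion id).card * 2 = Fintype.card V * 6 := by
    refine Finset.card_mul_eq_card_mul (fun e x => x ∈ e) ?_ ?_ (t := Finset.univ)
    · intro e he
      obtain ⟨C, hC, he⟩ := Finset.mem_biUnion.1 he
      induction e with | h a b =>
      obtain ⟨w, d, hs⟩ := hK.exists_star a
      obtain ⟨i, rfl⟩ := hs.exists_of_edge hC he
      have : Finset.bipartiteAbove (fun (e : Sym2 V) x => x ∈ e) Finset.univ s(a, w i) =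
          {a, w i} := by
        ext x; simp [Finset.mem_bipartiteAbove]
      rw [this, Finset.card_pair (hs.ne i)]
    · intro x _
      obtain ⟨w, d, hs⟩ := hK.exists_star x
      exact hs.card_edges
  have hsum : K.card = ({C ∈ K | C.card = 3}).card + ({C ∈ K | C.card = 4}).card := by
    have hK' : {C ∈ K | ¬ C.card = 3} = {C ∈ K | C.card = 4} := by
      refine Finset.filter_congr fun C hC => ⟨fun hne => ?_, fun h => by omega⟩
      obtain ⟨l, hl, hnd, rfl⟩ := hK.1.1.1.1 C hC
      obtain ⟨x, hx⟩ := List.exists_mem_of_length_pos (by omega : 0 < l.length)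
      have hl' : l ≠ [] := List.ne_nil_of_mem hx
      obtain ⟨w, d, hs⟩ := hK.exists_star x
      rcases hs.complete _ hC ((onCycle_polygon hl').2 hx) with h | ⟨i, hi, h⟩
      · rw [h, card_polygon hs.quad.1 (by simp)]; rfl
      · exact absurd (by rw [h, card_polygon (hs.tri i hi).1 (by simp)]; rfl) hne
    rw [← hK', Finset.card_filter_add_card_filter_not]
  omega

theorem IsSemiEquivelarMap.eulerChar_mul (hK : IsSemiEquivelarMap K [3, 3, 3, 3, 3, 4]) :
    eulerChar K * 12 = -Fintype.card V := by
  have := hK.card_faces_edges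
  rw [eulerChar]
  omega

end Counting

/-! ### The three models -/

section Models

/-- The vertex cycles of the faces of the three models. -/
def modelFaces : Fin 3 → List (List (Fin 12)) := ![
  [[0, 1, 2], [0, 1, 7], [0, 4, 5], [0, 5, 6], [0, 6, 7], [1, 2, 8], [1, 5, 8], [1, 5, 10],
   [2, 3, 6], [2, 6, 7], [2, 7, 8], [3, 4, 11], [3, 6, 9], [3, 9, 10], [3, 10, 11], [4, 5, 10],
   [4, 9, 10], [4, 9, 11], [7, 8, 11], [8, 9, 11], [0, 2, 3, 4], [1, 7, 11, 10], [5, 6, 9, 8]],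
  [[0, 1, 2], [0, 1, 7], [0, 4, 5], [0, 5, 6], [0, 6, 7], [1, 2, 9], [1, 7, 11], [1, 8, 9],
   [2, 3, 8], [2, 6, 8], [2, 6, 9], [3, 4, 11], [3, 8, 9], [3, 9, 10], [3, 10, 11], [4, 5, 10],
   [4, 7, 10], [4, 7, 11], [5, 6, 8], [5, 10, 11], [0, 2, 3, 4], [1, 8, 5, 11], [6, 7, 10, 9]],
  [[0, 1, 2], [0, 1, 7], [0, 4, 5], [0, 5, 6], [0, 6, 7], [1, 2, 9], [1, 7, 8], [1, 9, 11],
   [2, 3, 8], [2, 6, 8], [2, 6, 9], [3, 4, 11], [3, 7, 8], [3, 7, 10], [3, 10, 11], [4, 5, 10],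
   [4, 9, 10], [4, 9, 11], [5, 6, 8], [5, 10, 11], [0, 2, 3, 4], [8, 5, 11, 1], [6, 7, 10, 9]]]

theorem model_eq (i : Fin 3) : model i = ofLists (modelFaces i) := by
  fin_cases i <;> rfl

theorem mem_model {i : Fin 3} {C : Finset (Sym2 (Fin 12))} :
    C ∈ model i ↔ ∃ l ∈ modelFaces i, polygon l = C := by
  rw [model_eq, ofLists, List.mem_toFinset, List.mem_map]

/-- `x` and `y` are consecutive vertices of the cycle `l`. -/
def Consecutive (l : List (Fin 12)) (x y : Fin 12) : Prop :=
  (x, y) ∈ l.zip (l.rotate 1) ∨ (y, x) ∈ l.zip (l.rotate 1)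

instance (l : List (Fin 12)) (x y : Fin 12) : Decidable (Consecutive l x y) :=
  inferInstanceAs (Decidable (_ ∨ _))

theorem consecutive_iff {l : List (Fin 12)} {x y : Fin 12} :
    Consecutive l x y ↔ s(x, y) ∈ polygon l := by
  rw [polygon, List.mem_toFinset, ← List.map_uncurry_zip_eq_zipWith, List.mem_map]
  simp only [Prod.exists, Function.uncurry_apply_pair, Sym2.eq_iff, Consecutive]
  constructor
  · rintro (h | h)
    exacts [⟨_, _, h, Or.inl ⟨rfl, rfl⟩⟩, ⟨_, _, h, Or.inr ⟨rfl, rfl⟩⟩]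
  · rintro ⟨a, b, h, ⟨rfl, rfl⟩ | ⟨rfl, rfl⟩⟩
    exacts [Or.inl h, Or.inr h]

/-- The cycles `l` and `l'` meet exactly in the edge `xy`. -/
def MeetInPair (l l' : List (Fin 12)) (x y : Fin 12) : Prop :=
  (∀ z ∈ l, z ∈ l' → z = x ∨ z = y) ∧ Consecutive l x y ∧ Consecutive l' x y

instance (l l' : List (Fin 12)) (x y : Fin 12) : Decidable (MeetInPair l l' x y) :=
  inferInstanceAs (Decidable (_ ∧ _))

theorem nodup_of_mem_modelFaces :
    ∀ i, ∀ l ∈ modelFaces i, 3 ≤ l.length ∧ l.Nodup := by decide +kernel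

theorem modelFaces_eq_of_subset :
    ∀ i, ∀ l ∈ modelFaces i, ∀ l' ∈ modelFaces i, (∀ x ∈ l, x ∈ l') → l = l' := by decide +kernel

theorem modelFaces_meet : ∀ i, ∀ l ∈ modelFaces i, ∀ l' ∈ modelFaces i, l = l' ∨
    (∀ x ∈ l, x ∉ l') ∨ (∃ x ∈ l, x ∈ l' ∧ ∀ y ∈ l, y ∈ l' → y = x) ∨
    ∃ x ∈ l, ∃ y ∈ l, MeetInPair l l' x y := by decide +kernel

section

variable {i : Fin 3} {l l' : List (Fin 12)}

theorem onCycle_modelFaces (hl : l ∈ modelFaces i) {x : Fin 12} :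
    OnCycle x (polygon l) ↔ x ∈ l := by
  refine onCycle_polygon fun h => ?_
  have := (nodup_of_mem_modelFaces i l hl).1
  simp [h] at this

theorem polygon_injOn_modelFaces (hl : l ∈ modelFaces i) (hl' : l' ∈ modelFaces i)
    (h : polygon l = polygon l') : l = l' := by
  refine modelFaces_eq_of_subset i l hl l' hl' fun x hx => ?_
  rwa [← onCycle_modelFaces hl', ← h, onCycle_modelFaces hl]

theorem MeetInPair.meetInEdge {x y : Fin 12} (hl : l ∈ modelFaces i) (hl' : l' ∈ modelFaces i)
    (h : MeetInPair l l' x y) : MeetInEdge (polygon l) (polygon l') s(x, y) := by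
  refine ⟨consecutive_iff.1 h.2.1, consecutive_iff.1 h.2.2, fun z hz hz' => Sym2.mem_iff.2 ?_⟩
  exact h.1 z ((onCycle_modelFaces hl).1 hz) ((onCycle_modelFaces hl').1 hz')

end

theorem isPolyhedralComplex_model (i : Fin 3) : IsPolyhedralComplex (model i) := by
  constructor
  · intro C hC
    obtain ⟨l, hl, rfl⟩ := mem_model.1 hC
    obtain ⟨h₁, h₂⟩ := nodup_of_mem_modelFaces i l hl
    exact ⟨l, h₁, h₂, rfl⟩
  · intro C hC D hD hCD
    obtain ⟨l, hl, rfl⟩ := mem_model.1 hC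
    obtain ⟨l', hl', rfl⟩ := mem_model.1 hD
    rcases modelFaces_meet i l hl l' hl' with rfl | h | ⟨x, hx, hx', h⟩ | ⟨x, -, y, -, h⟩
    · exact absurd rfl hCD
    · refine Or.inl fun x hx => ?_
      rw [onCycle_modelFaces hl, onCycle_modelFaces hl'] at hx
      exact h x hx.1 hx.2
    · refine Or.inr (Or.inl ⟨x, fun y => ?_⟩)
      rw [onCycle_modelFaces hl, onCycle_modelFaces hl']
      exact ⟨fun hy => h y hy.1 hy.2, by rintro rfl; exact ⟨hx, hx'⟩⟩
    · exact Or.inr (Or.inr ⟨_, h.meetInEdge hl hl'⟩)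

/-- The neighbours of the vertex `x` of a model in cyclic order, beginning and ending on the
quadrangle at `x`. -/
def modelNbr : Fin 3 → Fin 12 → Fin 6 → Fin 12 := ![
  ![![2, 1, 7, 6, 5, 4], ![7, 0, 2, 8, 5, 10], ![3, 6, 7, 8, 1, 0], ![4, 11, 10, 9, 6, 2],
    ![0, 5, 10, 9, 11, 3], ![6, 0, 4, 10, 1, 8], ![9, 3, 2, 7, 0, 5],
    ![11, 8, 2, 6, 0, 1], ![5, 1, 2, 7, 11, 9], ![8, 11, 4, 10, 3, 6],
    ![1, 5, 4, 9, 3, 11], ![10, 3, 4, 9, 8, 7]],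
  ![![2, 1, 7, 6, 5, 4], ![8, 9, 2, 0, 7, 11], ![3, 8, 6, 9, 1, 0], ![4, 11, 10, 9, 8, 2],
    ![0, 5, 10, 7, 11, 3], ![11, 10, 4, 0, 6, 8], ![7, 0, 5, 8, 2, 9],
    ![10, 4, 11, 1, 0, 6], ![5, 6, 2, 3, 9, 1], ![6, 2, 1, 8, 3, 10],
    ![9, 3, 11, 5, 4, 7], ![1, 7, 4, 3, 10, 5]],
  ![![2, 1, 7, 6, 5, 4], ![8, 7, 0, 2, 9, 11], ![3, 8, 6, 9, 1, 0], ![4, 11, 10, 7, 8, 2],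
    ![0, 5, 10, 9, 11, 3], ![11, 10, 4, 0, 6, 8], ![7, 0, 5, 8, 2, 9],
    ![10, 3, 8, 1, 0, 6], ![5, 6, 2, 3, 7, 1], ![6, 2, 1, 11, 4, 10],
    ![9, 4, 5, 11, 3, 7], ![1, 9, 4, 3, 10, 5]]]

/-- The face of a model with the consecutive edges from `x` to its neighbours `j` and `j + 1`. -/
def faceAt (i : Fin 3) (x : Fin 12) (j : Fin 6) : List (Fin 12) :=
  ((modelFaces i).find? fun l => x ∈ l ∧ modelNbr i x j ∈ l ∧ modelNbr i x (j + 1) ∈ l).getD []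

theorem faceAt_mem : ∀ i x j, faceAt i x j ∈ modelFaces i ∧ x ∈ faceAt i x j := by decide +kernel

theorem faceAt_injective : ∀ i x, Function.Injective (faceAt i x) := by decide +kernel

theorem faceAt_complete : ∀ i x, ∀ l ∈ modelFaces i, x ∈ l → ∃ j, faceAt i x j = l := by
  decide +kernel

theorem length_faceAt :
    ∀ i x, ∀ j : Fin 6, (faceAt i x j).length = [3, 3, 3, 3, 3, 4].get j := by decide +kernel

theorem modelNbr_injective : ∀ i x, Function.Injective fun j => modelNbr i x (j + 1) := by
  decide +kernel

theorem faceAt_meet : ∀ i x j,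
    MeetInPair (faceAt i x j) (faceAt i x (j + 1)) x (modelNbr i x (j + 1)) := by decide +kernel

theorem hasFaceSequence_model (i : Fin 3) (x : Fin 12) :
    HasFaceSequence (model i) x [3, 3, 3, 3, 3, 4] := by
  have hm := fun j => (faceAt_mem i x j).1
  refine ⟨fun j => polygon (faceAt i x j), ⟨fun j k h => ?_, fun C => ⟨?_, ?_⟩,
    _, modelNbr_injective i x, fun j => ?_⟩, fun j => ?_⟩
  · exact faceAt_injective i x (polygon_injOn_modelFaces (hm j) (hm k) h)
  · rintro ⟨hC, hx⟩
    obtain ⟨l, hl, rfl⟩ := mem_model.1 hC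
    obtain ⟨j, hj⟩ := faceAt_complete i x l hl ((onCycle_modelFaces hl).1 hx)
    exact ⟨j, congrArg polygon hj⟩
  · rintro ⟨j, rfl⟩
    exact ⟨mem_model.2 ⟨_, hm j, rfl⟩, (onCycle_modelFaces (hm j)).2 (faceAt_mem i x j).2⟩
  · rw [finRotate_apply]
    exact (faceAt_meet i x j).meetInEdge (hm j) (hm _)
  · have h := nodup_of_mem_modelFaces i _ (hm j)
    exact (card_polygon h.2 h.1).trans (length_faceAt i x j)

/-- Every vertex other than `0` has a smaller neighbour, so the edge graph is connected. -/
theorem exists_edge_lt :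
    ∀ i, ∀ x : Fin 12, x ≠ 0 → ∃ y < x, ∃ l ∈ modelFaces i, Consecutive l x y := by
  decide +kernel

theorem connected_model (i : Fin 3) : (edgeGraph (model i)).Connected := by
  have h0 : ∀ x, (edgeGraph (model i)).Reachable x 0 := by
    intro x
    induction x using WellFoundedLT.induction with
    | ind x ih =>
      by_cases hx : x = 0
      · rw [hx]
      · obtain ⟨y, hy, l, hl, hxy⟩ := exists_edge_lt i x hx
        have hadj : (edgeGraph (model i)).Adj x y := (SimpleGraph.fromEdgeSet_adj _).2
          ⟨⟨_, mem_model.2 ⟨l, hl, rfl⟩, consecutive_iff.1 hxy⟩, hy.ne'⟩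
        exact hadj.reachable.trans (ih y hy)
  exact (SimpleGraph.connected_iff _).2 ⟨fun x y => (h0 x).trans (h0 y).symm, ⟨0⟩⟩

theorem isSemiEquivelarMap_model (i : Fin 3) :
    IsSemiEquivelarMap (model i) [3, 3, 3, 3, 3, 4] := by
  refine ⟨⟨⟨isPolyhedralComplex_model i, fun x => ?_⟩, connected_model i⟩, hasFaceSequence_model i⟩
  obtain ⟨F, hF, -⟩ := hasFaceSequence_model i x
  exact ⟨_, by simp, F, hF⟩

theorem eulerChar_model (i : Fin 3) : eulerChar (model i) = -1 := by
  have := (isSemiEquivelarMap_model i).eulerChar_mul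
  rw [Fintype.card_fin] at this
  omega

/-! ### The graphs of common neighbours -/

theorem edgeGraph_model_adj {i : Fin 3} {x y : Fin 12} :
    (edgeGraph (model i)).Adj x y ↔ ∃ j, modelNbr i x j = y := by
  have key : ∀ i x y, (x ≠ y ∧ ∃ l ∈ modelFaces i, Consecutive l x y) ↔
      ∃ j, modelNbr i x j = y := by decide +kernel
  rw [← key, edgeGraph, SimpleGraph.fromEdgeSet_adj, and_comm]
  refine and_congr_right fun _ => ?_
  simp only [Set.mem_ofPred_eq, consecutive_iff, mem_model]
  exact ⟨fun ⟨_, ⟨l, hl, h⟩, he⟩ => ⟨l, hl, h ▸ he⟩, fun ⟨l, hl, h⟩ => ⟨_, ⟨l, hl, rfl⟩, h⟩⟩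

theorem commonGraph_model_adj {i : Fin 3} {t : ℕ} {x y : Fin 12} :
    (commonGraph (model i) t).Adj x y ↔
      x ≠ y ∧ ({j | ∃ k, modelNbr i y k = modelNbr i x j} : Finset (Fin 6)).card = t := by
  have hinj : Function.Injective (modelNbr i x) := by
    intro j k h
    have := @modelNbr_injective i x (j - 1) (k - 1) (by simpa using h)
    simpa using this
  have hset : (edgeGraph (model i)).neighborSet x ∩ (edgeGraph (model i)).neighborSet y =
      ({j | ∃ k, modelNbr i y k = modelNbr i x j} : Finset (Fin 6)).image (modelNbr i x) := by
    ext z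
    simp only [Set.mem_inter_iff, SimpleGraph.mem_neighborSet, edgeGraph_model_adj,
      Finset.coe_image, Finset.coe_filter, Set.mem_image, Set.mem_ofPred_eq, Finset.mem_univ,
      true_and]
    constructor
    · rintro ⟨⟨j, rfl⟩, h⟩
      exact ⟨j, h, rfl⟩
    · rintro ⟨j, h, rfl⟩
      exact ⟨⟨j, rfl⟩, h⟩
  change _ ∧ _ ↔ _
  rw [hset, Set.ncard_coe_finset, Finset.card_image_of_injective _ hinj]

instance (i : Fin 3) (t : ℕ) : DecidableRel (commonGraph (model i) t).Adj :=
  fun _ _ => decidable_of_iff _ commonGraph_model_adj.symm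

/-- The number of vertices of degree three in `G₄` distinguishes the models. -/
theorem card_degree_eq_three : ∀ i,
    ({x | (commonGraph (model i) 4).degree x = 3} : Finset (Fin 12)).card = ![4, 2, 3] i := by
  decide +kernel

theorem degree_commonGraph_model : ∀ i, ∃ x y,
    (commonGraph (model i) 4).degree x ≠ (commonGraph (model i) 4).degree y := by
  decide +kernel

end Models

/-! ### Invariance under isomorphisms -/

section Invariance

variable {V W : Type*} {K : Finset (Finset (Sym2 V))} {L : Finset (Finset (Sym2 W))} {f : V ≃ W}

theorem IsIsomorphism.edgeGraph_adj_iff (h : IsIsomorphism K L f) (x y : V) :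
    (edgeGraph L).Adj (f x) (f y) ↔ (edgeGraph K).Adj x y := by
  simp only [edgeGraph, SimpleGraph.fromEdgeSet_adj, Set.mem_ofPred_eq, f.injective.ne_iff]
  refine and_congr_left fun _ => ⟨?_, ?_⟩
  · rintro ⟨D, hD, hxy⟩
    have hDf : (D.map f.symm.toEmbedding.sym2Map).map f.toEmbedding.sym2Map = D := by
      rw [Finset.map_map]
      convert Finset.map_refl
      ext e
      induction e with | h a b => simp [Function.Embedding.sym2Map]
    refine ⟨D.map f.symm.toEmbedding.sym2Map, (h _).2 (hDf.symm ▸ hD), ?_⟩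
    exact Finset.mem_map.2 ⟨_, hxy, by simp [Function.Embedding.sym2Map]⟩
  · rintro ⟨C, hC, hxy⟩
    exact ⟨_, (h C).1 hC, Finset.mem_map.2 ⟨_, hxy, rfl⟩⟩

/-- Isomorphic maps have isomorphic graphs of common neighbours. -/
def IsIsomorphism.commonGraphIso (h : IsIsomorphism K L f) (t : ℕ) :
    commonGraph K t ≃g commonGraph L t where
  toEquiv := f
  map_rel_iff' := by
    intro x y
    have hn : ∀ x, (edgeGraph L).neighborSet (f x) = f '' (edgeGraph K).neighborSet x := by
      intro x
      ext z
      obtain ⟨y, rfl⟩ := f.surjective z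
      simp [h.edgeGraph_adj_iff]
    change _ ∧ _ ↔ _ ∧ _
    rw [hn, hn, ← Set.image_inter f.injective, Set.ncard_image_of_injective _ f.injective,
      f.injective.ne_iff]

theorem isEmpty_commonGraph_iso {i j : Fin 3} (hij : i ≠ j) :
    IsEmpty (commonGraph (model i) 4 ≃g commonGraph (model j) 4) := by
  refine ⟨fun g => hij ?_⟩
  have hcard : ({x | (commonGraph (model i) 4).degree x = 3} : Finset (Fin 12)).card =
      ({x | (commonGraph (model j) 4).degree x = 3} : Finset (Fin 12)).card := by
    refine Finset.card_bij (fun x _ => g x) (fun x hx => ?_) (fun x _ y _ h => g.injective h)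
      fun y hy => ⟨g.symm y, ?_, by simp⟩
    · simpa [g.degree_eq] using hx
    · simpa [g.symm.degree_eq] using hy
  rw [card_degree_eq_three, card_degree_eq_three] at hcard
  have key : ∀ i j : Fin 3, (![4, 2, 3] : Fin 3 → ℕ) i = ![4, 2, 3] j → i = j := by decide
  exact key i j hcard

end Invariance

/-! ### The exhaustive search -/

section Search

/-! The vertices are labelled by `0, …, 11` such that the quadrangles are `a, a + 3, a + 6, a + 9`
modulo `12`. The search extends a partial collection of triangles. It is kept as a number `M` whose
binary digit `144 a + 12 b + c` records that `b` and `c` are consecutive neighbours of `a`, so that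
a triangle occupies six digits and a corner of a quadrangle two. A second number `N` records in its
digit `12 a + b` that `b` is a neighbour of `a`.

The definitions are evaluated by the kernel, which computes `Nat.land` and the like on literals at
once. For the sake of speed they name these functions and the recursors directly, instead of going
through type classes, pattern matching and structural recursion. -/

/-- `if c then t else e`, directly by the recursor. -/
abbrev select (c t e : Bool) : Bool := Bool.rec e t c

/-- `k x`, where the evaluation of `x` is forced first. -/
def strict (x : ℕ) (k : ℕ → Bool) : Bool := Nat.rec (k (nat_lit 0)) (fun n _ => k (Nat.succ n)) x

/-- The conjunction of `p c` over `c < n`. -/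
def allBelow (n : ℕ) (p : ℕ → Bool) : Bool := Nat.rec true (fun c ih => select (p c) ih false) n

/-- The position `144 a + 12 b + c` of the entry `(a, b, c)`. -/
def entry (a b c : ℕ) : ℕ := Nat.add (Nat.add (Nat.mul (nat_lit 144) a) (Nat.mul (nat_lit 12) b)) c

/-- The number whose only digit `1` is the entry `(a, b, c)`. -/
def entryBit (a b c : ℕ) : ℕ := Nat.shiftLeft (nat_lit 1) (entry a b c)

/-- The set of the `c` for which `M` has the entry `(a, b, c)`, in twelve binary digits. -/
def row (M a b : ℕ) : ℕ := Nat.land (Nat.shiftRight M (entry a b (nat_lit 0))) (nat_lit 4095)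

/-- The number whose only digit `1` is at `12 a + b`. -/
def pairBit (a b : ℕ) : ℕ := Nat.shiftLeft (nat_lit 1) (Nat.add (Nat.mul (nat_lit 12) a) b)

/-- The set of the recorded neighbours of `a`, in twelve binary digits. -/
def nbrs (N a : ℕ) : ℕ := Nat.land (Nat.shiftRight N (Nat.mul (nat_lit 12) a)) (nat_lit 4095)

/-- Adds the triangle `abc` to the table of consecutive neighbours. -/
def addTri (M a b c : ℕ) : ℕ :=
  Nat.lor M (Nat.lor (entryBit a b c) (Nat.lor (entryBit a c b) (Nat.lor (entryBit b a c)
    (Nat.lor (entryBit b c a) (Nat.lor (entryBit c a b) (entryBit c b a))))))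

/-- Adds the edges of the triangle `abc` to the table of neighbours. -/
def addNbrs (N a b c : ℕ) : ℕ :=
  Nat.lor N (Nat.lor (pairBit a b) (Nat.lor (pairBit a c) (Nat.lor (pairBit b a)
    (Nat.lor (pairBit b c) (Nat.lor (pairBit c a) (pairBit c b))))))

/-- Deletes the lowest binary digit `1`. -/
def dropBit (x : ℕ) : ℕ := Nat.land x (Nat.sub x (nat_lit 1))

/-- The number `x` has at most two binary digits `1`. -/
def atMostTwo (x : ℕ) : Bool := Nat.beq (dropBit (dropBit x)) (nat_lit 0)

/-- The number `x` has at most six binary digits `1`. -/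
def atMostSix (x : ℕ) : Bool :=
  Nat.beq (dropBit (dropBit (dropBit (dropBit (dropBit (dropBit x)))))) (nat_lit 0)

/-- In the recorded part of the link of `a`, a walk that comes from `prev` to `cur` and does not turn
back reaches `t` in at most `n` further steps. -/
def reaches (M a t n : ℕ) : ℕ → ℕ → Bool :=
  Nat.rec (fun _ _ => false) (fun _ ih prev cur =>
    strict (Nat.land (row M a cur)
        (Nat.sub (nat_lit 4095) (Nat.shiftLeft (nat_lit 1) prev))) fun r =>
      select (Nat.beq r (nat_lit 0)) false
        (strict (Nat.log2 r) fun d => select (Nat.beq d t) true (ih cur d))) n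

/-- The vertex opposite to `a` on its quadrangle. -/
def opposite (a : ℕ) : ℕ := Nat.mod (Nat.add a (nat_lit 6)) (nat_lit 12)

/-- The triangle `abc` passes the tests for a partial map, where `M` and `N` already contain it and
`ab` was an edge of a known face: no side joins opposite vertices of a quadrangle, no edge is on
three faces, no vertex has seven neighbours, and no link contains a cycle with fewer than six
vertices. -/
def admissible (M N a b c : ℕ) : Bool :=
  select (Nat.beq (opposite a) c) false <|
  select (Nat.beq (opposite b) c) false <|
  select (atMostTwo (row M a c)) (select (atMostTwo (row M b c))
  (select (atMostSix (nbrs N a)) (select (atMostSix (nbrs N b)) (select (atMostSix (nbrs N c))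
  (select (reaches M a c (nat_lit 4) c b) false <|
   select (reaches M b a (nat_lit 4) a c) false <|
   select (reaches M c b (nat_lit 4) b a) false true)
  false) false) false) false) false

/-- `b + 1` for the largest `b < n` such that exactly one face at the edge `ab` is recorded, and `0`
if there is none. -/
def openEdge (M a n : ℕ) : ℕ :=
  Nat.rec (nat_lit 0) (fun b ih =>
    Bool.rec (Bool.rec ih (Nat.succ b)
      (Nat.beq (row M a b) (Nat.shiftLeft (nat_lit 1) (Nat.log2 (row M a b)))))
      ih (Nat.beq (row M a b) (nat_lit 0))) n

/-- The exhaustive search with `f` units of fuel. It completes the links of `a, a + 1, …, 11` one after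
the other: for an edge `ab` with a single recorded face, every admissible triangle `abc` is tried as
the other face. The result is `true` if all complete tables satisfy `accept`. -/
def search (accept : ℕ → Bool) (f : ℕ) : ℕ → ℕ → ℕ → Bool :=
  Nat.rec (fun _ _ _ => false) (fun _ ih a M N =>
    select (Nat.beq a (nat_lit 12)) (accept M) <|
    Nat.rec (ih (Nat.succ a) M N) (fun b _ => allBelow (nat_lit 12) fun c =>
      select (Nat.beq a c) true <| select (Nat.beq b c) true <|
      select (Nat.beq (nat_lit 0) (Nat.land (row M a b) (Nat.shiftLeft (nat_lit 1) c)))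
        ((fun M' N' => select (admissible M' N' a b c) (ih a M' N') true)
          (addTri M a b c) (addNbrs N a b c))
        true) (openEdge M a (nat_lit 12))) f

/-- The table with the corners of the three quadrangles. -/
def corners : ℕ :=
  (List.range 12).foldr (fun a M => Nat.lor (Nat.lor (entryBit a ((a + 3) % 12) ((a + 9) % 12))
    (entryBit a ((a + 9) % 12) ((a + 3) % 12))) M) 0

/-- The table with the edges of the three quadrangles. -/
def cornerNbrs : ℕ :=
  (List.range 12).foldr (fun a N => Nat.lor (Nat.lor (pairBit a ((a + 3) % 12))
    (pairBit a ((a + 9) % 12))) N) 0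

/-- The search from the three quadrangles and the triangles in `l`. The fuel suffices for the
`20` triangles, the `12` steps to the next vertex and the final test. -/
def searchFrom (accept : ℕ → Bool) (l : List (ℕ × ℕ × ℕ)) : Bool :=
  search accept 40 0 (l.foldr (fun t M => addTri M t.1 t.2.1 t.2.2) corners)
    (l.foldr (fun t N => addNbrs N t.1 t.2.1 t.2.2) cornerNbrs)

/-! ### Elementary properties of the tables -/

theorem strict_eq (x : ℕ) (k : ℕ → Bool) : strict x k = k x := by cases x <;> rfl

theorem select_eq (c t e : Bool) : select c t e = if c then t else e := by cases c <;> rfl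

theorem allBelow_iff {n : ℕ} {p : ℕ → Bool} : allBelow n p = true ↔ ∀ c < n, p c = true := by
  induction n with
  | zero => simp [allBelow]
  | succ n ih =>
    have : allBelow (n + 1) p = select (p n) (allBelow n p) false := rfl
    rw [this, Nat.forall_lt_succ_right, ← ih]
    cases p n <;> simp

theorem entry_eq (a b c : ℕ) : entry a b c = 144 * a + 12 * b + c := rfl

theorem testBit_entryBit (a b c n : ℕ) :
    (entryBit a b c).testBit n = true ↔ n = entry a b c := by
  change (1 <<< entry a b c).testBit n = true ↔ _
  rw [Nat.one_shiftLeft, Nat.testBit_two_pow]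
  simp [eq_comm]

theorem testBit_pairBit (a b n : ℕ) : (pairBit a b).testBit n = true ↔ n = 12 * a + b := by
  change (1 <<< (12 * a + b)).testBit n = true ↔ _
  rw [Nat.one_shiftLeft, Nat.testBit_two_pow]
  simp [eq_comm]

theorem testBit_lor (m n i : ℕ) :
    (Nat.lor m n).testBit i = true ↔ m.testBit i = true ∨ n.testBit i = true := by
  change (m ||| n).testBit i = true ↔ _
  simp

theorem testBit_land_shiftRight (m k c : ℕ) :
    (Nat.land (Nat.shiftRight m k) 4095).testBit c = true ↔ c < 12 ∧ m.testBit (k + c) = true := by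
  change ((m >>> k) &&& (2 ^ 12 - 1)).testBit c = true ↔ _
  rw [Nat.testBit_and, Nat.testBit_shiftRight, Nat.testBit_two_pow_sub_one]
  simp [and_comm]

theorem testBit_row {M a b c : ℕ} :
    (row M a b).testBit c = true ↔ c < 12 ∧ M.testBit (entry a b c) = true :=
  testBit_land_shiftRight _ _ _

theorem testBit_nbrs {N a b : ℕ} :
    (nbrs N a).testBit b = true ↔ b < 12 ∧ N.testBit (12 * a + b) = true :=
  testBit_land_shiftRight _ _ _

/-- The positions below `12` of the binary digits `1` of `x`. -/
def digits (x : ℕ) : Finset ℕ := {i ∈ Finset.range 12 | x.testBit i = true}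

theorem card_digits_dropBit {x : ℕ} (hx : ∀ i, x.testBit i = true → i < 12) (h0 : x ≠ 0) :
    (digits (dropBit x)).card < (digits x).card := by
  have hle : dropBit x < x := lt_of_le_of_lt Nat.and_le_right (by change x - 1 < x; omega)
  have hsub : ∀ i, (dropBit x).testBit i = true → x.testBit i = true := fun i hi => by
    change (x &&& (x - 1)).testBit i = true at hi
    simp at hi; exact hi.1
  refine Finset.card_lt_card ⟨fun i hi => ?_, fun h => hle.ne (Nat.eq_of_testBit_eq fun i => ?_)⟩
  · simp only [digits, Finset.mem_filter] at hi ⊢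
    exact ⟨hi.1, hsub i hi.2⟩
  · rw [Bool.eq_iff_iff]
    refine ⟨hsub i, fun hi => ?_⟩
    have := @h i (by simp [digits, hi, hx i hi])
    simp only [digits, Finset.mem_filter] at this
    exact this.2

theorem dropBit_iterate_eq_zero {n : ℕ} : ∀ {x : ℕ}, (∀ i, x.testBit i = true → i < 12) →
    (digits x).card ≤ n → dropBit^[n] x = 0 := by
  induction n with
  | zero =>
    intro x hx h
    by_contra h0
    have := card_digits_dropBit hx h0
    omega
  | succ n ih =>
    intro x hx h
    rw [Function.iterate_succ_apply]
    by_cases h0 : x = 0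
    · subst h0
      exact ih (by simp [dropBit]) (by simp [digits, dropBit])
    · refine ih (fun i hi => hx i ?_) (by have := card_digits_dropBit hx h0; omega)
      change (x &&& (x - 1)).testBit i = true at hi
      simp at hi; exact hi.1

/-- The corner of a quadrangle at `a`, listed in either direction. -/
def Corner (a b c : ℕ) : Prop :=
  b = (a + 3) % 12 ∧ c = (a + 9) % 12 ∨ b = (a + 9) % 12 ∧ c = (a + 3) % 12

/-- `T` is the relation of forming a triangle, for vertices labelled by `0, …, 11` such that the
quadrangles are `a, a + 3, a + 6, a + 9` modulo `12`: it is symmetric, opposite vertices of a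
quadrangle are on no triangle, and the triangles and the quadrangle at a vertex form a `6`-cycle. -/
structure Labelling (T : ℕ → ℕ → ℕ → Prop) : Prop where
  swap_left : ∀ {a b c}, T a b c → T b a c
  swap_right : ∀ {a b c}, T a b c → T a c b
  lt : ∀ {a b c}, T a b c → a < 12
  ne : ∀ {a b c}, T a b c → a ≠ b
  ne_opposite : ∀ {a b c}, T a b c → (a + 6) % 12 ≠ b
  link : ∀ a < 12, ∃ w : ZMod 6 → ℕ, Function.Injective w ∧ ∀ b c, T a b c ∨ Corner a b c ↔
    ∃ i, b = w i ∧ c = w (i + 1) ∨ c = w i ∧ b = w (i + 1)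

variable {T : ℕ → ℕ → ℕ → Prop}

/-- The entries of the table `M` are corners of triangles or quadrangles. -/
def Sound (T : ℕ → ℕ → ℕ → Prop) (M : ℕ) : Prop :=
  ∀ a b c, b < 12 → c < 12 → M.testBit (entry a b c) = true → a < 12 ∧ (T a b c ∨ Corner a b c)

/-- The entries of the table `N` are edges. -/
def SoundNbrs (T : ℕ → ℕ → ℕ → Prop) (N : ℕ) : Prop :=
  ∀ a b, b < 12 → N.testBit (12 * a + b) = true → a < 12 ∧ ∃ c, T a b c ∨ Corner a b c

/-- The table `M` contains the corners of the quadrangles. -/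
def HasCorners (M : ℕ) : Prop :=
  ∀ a < 12, ∀ b c, Corner a b c → M.testBit (entry a b c) = true

theorem Corner.lt {a b c : ℕ} (h : Corner a b c) : b < 12 ∧ c < 12 := by
  unfold Corner at h; omega

end Search

/-! ### Soundness of the search -/

section Soundness

variable {T : ℕ → ℕ → ℕ → Prop}

theorem natBeq_eq_false {a b : ℕ} : Nat.beq a b = false ↔ a ≠ b := by
  rw [← Bool.not_eq_true, Nat.beq_eq]

namespace Labelling

theorem lt₂ (hT : Labelling T) {a b c : ℕ} (h : T a b c) : b < 12 := hT.lt (hT.swap_left h)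

theorem lt₃ (hT : Labelling T) {a b c : ℕ} (h : T a b c) : c < 12 :=
  hT.lt (hT.swap_left (hT.swap_right h))

theorem rotate (hT : Labelling T) {a b c : ℕ} (h : T a b c) : T b c a :=
  hT.swap_right (hT.swap_left h)

theorem sound_addTri (hT : Labelling T) {M a b c : ℕ} (hM : Sound T M) (h : T a b c) :
    Sound T (addTri M a b c) := by
  have ha := hT.lt h
  have hb := hT.lt₂ h
  have hc := hT.lt₃ h
  intro x y z hy hz hbit
  simp only [addTri, testBit_lor, testBit_entryBit, entry_eq] at hbit
  rcases hbit with h' | h' | h' | h' | h' | h' | h'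
  · exact hM x y z hy hz h'
  · obtain ⟨rfl, rfl, rfl⟩ : x = a ∧ y = b ∧ z = c := by omega
    exact ⟨ha, Or.inl h⟩
  · obtain ⟨rfl, rfl, rfl⟩ : x = a ∧ y = c ∧ z = b := by omega
    exact ⟨ha, Or.inl (hT.swap_right h)⟩
  · obtain ⟨rfl, rfl, rfl⟩ : x = b ∧ y = a ∧ z = c := by omega
    exact ⟨hb, Or.inl (hT.swap_left h)⟩
  · obtain ⟨rfl, rfl, rfl⟩ : x = b ∧ y = c ∧ z = a := by omega
    exact ⟨hb, Or.inl (hT.rotate h)⟩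
  · obtain ⟨rfl, rfl, rfl⟩ : x = c ∧ y = a ∧ z = b := by omega
    exact ⟨hc, Or.inl (hT.rotate (hT.rotate h))⟩
  · obtain ⟨rfl, rfl, rfl⟩ : x = c ∧ y = b ∧ z = a := by omega
    exact ⟨hc, Or.inl (hT.swap_left (hT.rotate h))⟩

theorem soundNbrs_addNbrs (hT : Labelling T) {N a b c : ℕ} (hN : SoundNbrs T N) (h : T a b c) :
    SoundNbrs T (addNbrs N a b c) := by
  have ha := hT.lt h
  have hb := hT.lt₂ h
  have hc := hT.lt₃ h
  intro x y hy hbit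
  simp only [addNbrs, testBit_lor, testBit_pairBit] at hbit
  rcases hbit with h' | h' | h' | h' | h' | h' | h'
  · exact hN x y hy h'
  · obtain ⟨rfl, rfl⟩ : x = a ∧ y = b := by omega
    exact ⟨ha, _, Or.inl h⟩
  · obtain ⟨rfl, rfl⟩ : x = a ∧ y = c := by omega
    exact ⟨ha, _, Or.inl (hT.swap_right h)⟩
  · obtain ⟨rfl, rfl⟩ : x = b ∧ y = a := by omega
    exact ⟨hb, _, Or.inl (hT.swap_left h)⟩
  · obtain ⟨rfl, rfl⟩ : x = b ∧ y = c := by omega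
    exact ⟨hb, _, Or.inl (hT.rotate h)⟩
  · obtain ⟨rfl, rfl⟩ : x = c ∧ y = a := by omega
    exact ⟨hc, _, Or.inl (hT.rotate (hT.rotate h))⟩
  · obtain ⟨rfl, rfl⟩ : x = c ∧ y = b := by omega
    exact ⟨hc, _, Or.inl (hT.swap_left (hT.rotate h))⟩

/-- A vertex of the link of `a` has at most two neighbours there. -/
theorem atMostTwo_row (hT : Labelling T) {M a : ℕ} (ha : a < 12) (hM : Sound T M) {b : ℕ}
    (hb : b < 12) : atMostTwo (row M a b) = true := by
  obtain ⟨w, hw, hlink⟩ := hT.link a ha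
  have hcard : (digits (row M a b)).card ≤ 2 := by
    have hmem : ∀ c ∈ digits (row M a b), T a b c ∨ Corner a b c := by
      intro c hc
      simp only [digits, Finset.mem_filter, testBit_row] at hc
      exact (hM a b c hb hc.2.1 hc.2.2).2
    rcases (digits (row M a b)).eq_empty_or_nonempty with h0 | ⟨c, hc⟩
    · simp [h0]
    · obtain ⟨m, rfl⟩ : ∃ m, b = w m := by
        obtain ⟨i, h | h⟩ := (hlink b c).1 (hmem c hc)
        exacts [⟨_, h.1⟩, ⟨_, h.2⟩]
      refine (Finset.card_le_card (t := {w (m + 1), w (m - 1)}) fun e he => ?_).trans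
        Finset.card_le_two
      obtain ⟨i, ⟨h₁, h₂⟩ | ⟨h₁, h₂⟩⟩ := (hlink _ e).1 (hmem e he)
      · rw [h₂, ← hw h₁]; simp
      · rw [h₁, hw h₂]; simp
  have := dropBit_iterate_eq_zero (fun i hi => (testBit_row.1 hi).1) hcard
  change Nat.beq (dropBit^[2] (row M a b)) 0 = true
  rw [this]; rfl

theorem atMostSix_nbrs (hT : Labelling T) {N a : ℕ} (ha : a < 12) (hN : SoundNbrs T N) :
    atMostSix (nbrs N a) = true := by
  obtain ⟨w, hw, hlink⟩ := hT.link a ha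
  have hcard : (digits (nbrs N a)).card ≤ 6 := by
    refine (Finset.card_le_card (t := Finset.univ.image w) fun b hb => ?_).trans
      (Finset.card_image_le.trans (by simp))
    simp only [digits, Finset.mem_filter, testBit_nbrs] at hb
    obtain ⟨-, c, hc⟩ := hN a b hb.2.1 hb.2.2
    obtain ⟨i, h | h⟩ := (hlink b c).1 hc
    · simp [h.1]
    · simp [h.2]
  have := dropBit_iterate_eq_zero (fun i hi => (testBit_nbrs.1 hi).1) hcard
  change Nat.beq (dropBit^[6] (nbrs N a)) 0 = true
  rw [this]; rfl

theorem reaches_succ (M a t n prev cur : ℕ) : reaches M a t (n + 1) prev cur =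
    (let r := row M a cur &&& (4095 - 1 <<< prev)
     if r = 0 then false else if r.log2 = t then true else reaches M a t n cur r.log2) := by
  change strict (row M a cur &&& (4095 - 1 <<< prev)) (fun r => select (Nat.beq r 0) false
    (strict r.log2 fun d => select (Nat.beq d t) true (reaches M a t n cur d))) = _
  simp only [strict_eq, select_eq, Nat.beq_eq]

theorem testBit_log2 {n : ℕ} (h : n ≠ 0) : n.testBit n.log2 = true := by
  have h₁ := Nat.log2_self_le h
  have h₂ := @Nat.lt_log2_self n
  rw [Nat.testBit_eq_decide_div_mod_eq]
  have : n / 2 ^ n.log2 = 1 := by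
    refine Nat.div_eq_of_lt_le (by omega) ?_
    rw [pow_succ] at h₂; omega
  simp [this]

theorem testBit_mask_self {p : ℕ} (hp : p < 12) : (4095 - 1 <<< p).testBit p = false := by
  interval_cases p <;> decide

/-- A walk in the link of `a` that never turns back advances along the `6`-cycle with constant
direction `s = ±1`. -/
theorem exists_of_reaches {M a : ℕ} (hM : Sound T M) {w : ZMod 6 → ℕ}
    (hw : Function.Injective w) (hlink : ∀ b c, T a b c ∨ Corner a b c ↔
      ∃ i, b = w i ∧ c = w (i + 1) ∨ c = w i ∧ b = w (i + 1)) (hlt : ∀ i, w i < 12)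
    {s : ZMod 6} (hs : s = 1 ∨ s = -1) {i : ZMod 6} :
    ∀ {n : ℕ} {j : ZMod 6}, reaches M a (w i) n (w j) (w (j + s)) = true →
      ∃ k : ℕ, 1 ≤ k ∧ k ≤ n ∧ i = j + (k + 1) * s := by
  intro n
  induction n with
  | zero => intro j h; exact absurd h (by simp [reaches])
  | succ n ih =>
    intro j h
    rw [reaches_succ] at h
    dsimp only at h
    split_ifs at h with h0 h1
    all_goals
      have hbit := testBit_log2 h0
      set d := (row M a (w (j + s)) &&& (4095 - 1 <<< w j)).log2 with hd
      rw [Nat.testBit_and, Bool.and_eq_true, testBit_row] at hbit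
      obtain ⟨⟨hd12, hbit⟩, hprev⟩ := hbit
      have hdj : d ≠ w j := by
        intro h; rw [h, testBit_mask_self (hlt j)] at hprev; exact absurd hprev (by simp)
      have hds : d = w (j + s + s) := by
        obtain ⟨m, ⟨h₁, h₂⟩ | ⟨h₁, h₂⟩⟩ := (hlink _ d).1 (hM a _ d (hlt _) hd12 hbit).2
        · rcases hs with rfl | rfl
          · rw [h₂, ← hw h₁]
          · exfalso; apply hdj; rw [h₂, ← hw h₁]; congr 1; ring
        · rcases hs with rfl | rfl
          · exfalso; apply hdj; rw [h₁]; congr 1; exact (add_right_cancel (hw h₂)).symm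
          · rw [h₁]; congr 1; rw [hw h₂]; ring
    · refine ⟨1, le_rfl, by omega, ?_⟩
      rw [hw (h1.symm.trans hds)]; push_cast; ring
    · rw [hds] at h
      obtain ⟨k, hk₁, hk₂, hk⟩ := ih h
      exact ⟨k + 1, by omega, by omega, by rw [hk]; push_cast; ring⟩

/-- The link of a vertex contains no cycle of length less than six. -/
theorem reaches_eq_false (hT : Labelling T) {M a b c : ℕ} (hM : Sound T M) (h : T a b c) :
    reaches M a c 4 c b = false := by
  obtain ⟨w, hw, hlink⟩ := hT.link a (hT.lt h)
  have hlt : ∀ i, w i < 12 := fun i => by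
    rcases (hlink (w i) (w (i + 1))).2 ⟨i, Or.inl ⟨rfl, rfl⟩⟩ with h | h
    exacts [hT.lt₂ h, h.lt.1]
  by_contra hr
  rw [Bool.not_eq_false] at hr
  obtain ⟨i, s, hs, rfl, rfl⟩ : ∃ i s : ZMod 6, (s = 1 ∨ s = -1) ∧ c = w i ∧ b = w (i + s) := by
    obtain ⟨i, ⟨h₁, h₂⟩ | ⟨h₁, h₂⟩⟩ := (hlink b c).1 (Or.inl h)
    · exact ⟨i + 1, -1, Or.inr rfl, h₂, by rw [h₁]; congr 1; ring⟩
    · exact ⟨i, 1, Or.inl rfl, h₁, h₂⟩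
  obtain ⟨k, hk₁, hk₄, hk⟩ := exists_of_reaches hM hw hlink hlt hs hr
  have hk' : ((k : ZMod 6) + 1) * s = 0 := by simpa using hk
  clear hk hr
  rcases hs with rfl | rfl <;> interval_cases k <;> revert hk' <;> decide

theorem admissible_eq_true (hT : Labelling T) {M N a b c : ℕ} (hM : Sound T M)
    (hN : SoundNbrs T N) (h : T a b c) : admissible M N a b c = true := by
  have ha := hT.lt h
  have hb := hT.lt₂ h
  have hc := hT.lt₃ h
  have h₁ : Nat.beq (opposite a) c = false := by
    rw [natBeq_eq_false]; exact hT.ne_opposite (hT.swap_right h)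
  have h₂ : Nat.beq (opposite b) c = false := by
    rw [natBeq_eq_false]; exact hT.ne_opposite (hT.rotate h)
  have r₁ := hT.reaches_eq_false hM h
  have r₂ := hT.reaches_eq_false hM (hT.rotate h)
  have r₃ := hT.reaches_eq_false hM (hT.rotate (hT.rotate h))
  simp only [admissible, h₁, h₂, hT.atMostTwo_row ha hM hc, hT.atMostTwo_row hb hM hc,
    hT.atMostSix_nbrs ha hN, hT.atMostSix_nbrs hb hN, hT.atMostSix_nbrs hc hN, r₁, r₂, r₃]

theorem openEdge_spec (M a n : ℕ) : openEdge M a n = 0 ∨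
    ∃ b d, b < n ∧ openEdge M a n = b + 1 ∧ row M a b = 2 ^ d := by
  induction n with
  | zero => exact Or.inl rfl
  | succ n ih =>
    have hrec : openEdge M a (n + 1) = if row M a n = 0 then openEdge M a n else
        if row M a n = 2 ^ (row M a n).log2 then n + 1 else openEdge M a n := by
      change @Bool.rec (fun _ => ℕ) (@Bool.rec (fun _ => ℕ) (openEdge M a n) (n + 1)
        (Nat.beq (row M a n) (1 <<< (row M a n).log2))) (openEdge M a n)
        (Nat.beq (row M a n) 0) = _
      rw [Nat.one_shiftLeft]
      split_ifs with h0 h1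
      · rw [h0]; rfl
      · rw [← h1, Nat.beq_refl, natBeq_eq_false.2 h0]
      · rw [natBeq_eq_false.2 h1, natBeq_eq_false.2 h0]
    have lift : (openEdge M a n = 0 ∨
        ∃ b d, b < n ∧ openEdge M a n = b + 1 ∧ row M a b = 2 ^ d) → openEdge M a n = 0 ∨
        ∃ b d, b < n + 1 ∧ openEdge M a n = b + 1 ∧ row M a b = 2 ^ d := by
      rintro (h | ⟨b, d, hb, h⟩)
      exacts [Or.inl h, Or.inr ⟨b, d, by omega, h⟩]
    rw [hrec]
    split_ifs with h0 h1
    · exact lift ih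
    · exact Or.inr ⟨n, _, by omega, rfl, h1⟩
    · exact lift ih

theorem search_succ (accept : ℕ → Bool) (f a M N : ℕ) : search accept (f + 1) a M N =
    if a = 12 then accept M else
    match openEdge M a 12 with
    | 0 => search accept f (a + 1) M N
    | b + 1 => allBelow 12 fun c => if a = c then true else if b = c then true else
        if (row M a b).testBit c then true else
        if admissible (addTri M a b c) (addNbrs N a b c) a b c then
          search accept f a (addTri M a b c) (addNbrs N a b c) else true := by
  change select (Nat.beq a 12) (accept M) (Nat.rec (search accept f (a + 1) M N)
    (fun b _ => allBelow 12 fun c => select (Nat.beq a c) true <| select (Nat.beq b c) true <|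
      select (Nat.beq 0 (row M a b &&& 1 <<< c))
        (select (admissible (addTri M a b c) (addNbrs N a b c) a b c)
          (search accept f a (addTri M a b c) (addNbrs N a b c)) true) true)
    (openEdge M a 12)) = _
  have hbit : ∀ b c, Nat.beq 0 (row M a b &&& 1 <<< c) = !(row M a b).testBit c := by
    intro b c
    rw [Nat.one_shiftLeft, Nat.and_two_pow]
    cases (row M a b).testBit c
    · simp
    · rw [Bool.toNat_true, one_mul, Bool.not_true, natBeq_eq_false]
      positivity
  simp only [select_eq, Nat.beq_eq, hbit]
  cases openEdge M a 12 with
  | zero => rfl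
  | succ b =>
    simp only
    congr 2
    funext c
    cases (row M a b).testBit c <;> simp

/-- The search is exhaustive: if it succeeds then it has accepted a table of edges of links. -/
theorem exists_accept (hT : Labelling T) (accept : ℕ → Bool) : ∀ {f a M N : ℕ}, Sound T M →
    SoundNbrs T N → HasCorners M → search accept f a M N = true →
    ∃ M', Sound T M' ∧ accept M' = true := by
  intro f
  induction f with
  | zero => intro a M N _ _ _ h; exact absurd h (by simp [search])
  | succ f ih =>
    intro a M N hM hN hC h
    rw [search_succ] at h
    split_ifs at h with h12
    · exact ⟨M, hM, h⟩
    rcases openEdge_spec M a 12 with h0 | ⟨b, d, hb, hbe, hrow⟩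
    · rw [h0] at h
      exact ih hM hN hC h
    rw [hbe] at h
    simp only [allBelow_iff] at h
    have hd : (row M a b).testBit d = true := by rw [hrow, Nat.testBit_two_pow_self]
    obtain ⟨hd12, hd⟩ := testBit_row.1 hd
    obtain ⟨ha, hL⟩ := hM a b d hb hd12 hd
    obtain ⟨w, hw, hlink⟩ := hT.link a ha
    obtain ⟨c, hcd, hc⟩ : ∃ c, c ≠ d ∧ (T a b c ∨ Corner a b c) := by
      have h20 : (1 : ZMod 6) + 1 ≠ 0 := by decide
      obtain ⟨i, ⟨h₁, h₂⟩ | ⟨h₁, h₂⟩⟩ := (hlink b d).1 hL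
      · refine ⟨w (i - 1), fun h => h20 ?_, (hlink _ _).2 ⟨i - 1, Or.inr ⟨rfl, by simpa using h₁⟩⟩⟩
        have := hw (h.trans h₂)
        linear_combination -this
      · refine ⟨w (i + 1 + 1), fun h => h20 ?_, (hlink _ _).2 ⟨i + 1, Or.inl ⟨h₂, rfl⟩⟩⟩
        have := hw (h.trans h₁)
        linear_combination this
    have hbit : (row M a b).testBit c = false := by
      rw [hrow, Nat.testBit_two_pow]; simpa using hcd.symm
    -- All corners of quadrangles are recorded already, so the missing face at `ab` is a triangle.
    have hTc : T a b c := by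
      refine hc.resolve_right fun h => ?_
      rw [testBit_row.2 ⟨h.lt.2, hC a ha b c h⟩] at hbit
      exact absurd hbit (by simp)
    have hM' := hT.sound_addTri hM hTc
    have hN' := hT.soundNbrs_addNbrs hN hTc
    have := h c (hT.lt₃ hTc)
    rw [if_neg (hT.ne (hT.swap_right hTc)), if_neg (hT.ne (hT.rotate hTc)), hbit,
      if_neg Bool.false_ne_true, if_pos (hT.admissible_eq_true hM' hN' hTc)] at this
    refine ih hM' hN' (fun x hx y z hxyz => ?_) this
    rw [addTri, testBit_lor]
    exact Or.inl (hC x hx y z hxyz)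

theorem testBit_corners (n : ℕ) : corners.testBit n = true ↔
    ∃ a < 12, ∃ b c, Corner a b c ∧ n = entry a b c := by
  have key : ∀ l : List ℕ, (l.foldr (fun a M => Nat.lor (Nat.lor
      (entryBit a ((a + 3) % 12) ((a + 9) % 12)) (entryBit a ((a + 9) % 12) ((a + 3) % 12))) M)
      0).testBit n = true ↔ ∃ a ∈ l, ∃ b c, Corner a b c ∧ n = entry a b c := by
    intro l
    induction l with
    | nil => simp
    | cons a l ih =>
      rw [List.foldr_cons, testBit_lor, testBit_lor, testBit_entryBit, testBit_entryBit, ih,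
        List.exists_mem_cons_iff]
      refine or_congr ⟨?_, ?_⟩ Iff.rfl
      · rintro (h | h)
        exacts [⟨_, _, Or.inl ⟨rfl, rfl⟩, h⟩, ⟨_, _, Or.inr ⟨rfl, rfl⟩, h⟩]
      · rintro ⟨b, c, ⟨rfl, rfl⟩ | ⟨rfl, rfl⟩, h⟩
        exacts [Or.inl h, Or.inr h]
  have := key (List.range 12)
  simp only [List.mem_range] at this
  exact this

theorem testBit_cornerNbrs (n : ℕ) : cornerNbrs.testBit n = true ↔
    ∃ a < 12, ∃ b c, Corner a b c ∧ n = 12 * a + b := by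
  have key : ∀ l : List ℕ, (l.foldr (fun a N => Nat.lor (Nat.lor (pairBit a ((a + 3) % 12))
      (pairBit a ((a + 9) % 12))) N) 0).testBit n = true ↔
      ∃ a ∈ l, ∃ b c, Corner a b c ∧ n = 12 * a + b := by
    intro l
    induction l with
    | nil => simp
    | cons a l ih =>
      rw [List.foldr_cons, testBit_lor, testBit_lor, testBit_pairBit, testBit_pairBit, ih,
        List.exists_mem_cons_iff]
      refine or_congr ⟨?_, ?_⟩ Iff.rfl
      · rintro (h | h)
        exacts [⟨_, _, Or.inl ⟨rfl, rfl⟩, h⟩, ⟨_, _, Or.inr ⟨rfl, rfl⟩, h⟩]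
      · rintro ⟨b, c, ⟨rfl, rfl⟩ | ⟨rfl, rfl⟩, h⟩
        exacts [Or.inl h, Or.inr h]
  have := key (List.range 12)
  simp only [List.mem_range] at this
  exact this

theorem exists_accept_of_searchFrom (hT : Labelling T) {accept : ℕ → Bool}
    {l : List (ℕ × ℕ × ℕ)} (hl : ∀ t ∈ l, T t.1 t.2.1 t.2.2)
    (h : searchFrom accept l = true) : ∃ M, Sound T M ∧ accept M = true := by
  refine hT.exists_accept accept ?_ ?_ ?_ h
  · clear h
    induction l with
    | nil =>
      intro a b c hb hc hbit
      obtain ⟨x, hx, y, z, hxyz, h⟩ := (testBit_corners _).1 hbit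
      have := hxyz.lt
      rw [entry_eq, entry_eq] at h
      obtain ⟨rfl, rfl, rfl⟩ : a = x ∧ b = y ∧ c = z := by omega
      exact ⟨hx, Or.inr hxyz⟩
    | cons t l ih =>
      exact hT.sound_addTri (ih fun t ht => hl t (List.mem_cons_of_mem _ ht))
        (hl t List.mem_cons_self)
  · clear h
    induction l with
    | nil =>
      intro a b hb hbit
      obtain ⟨x, hx, y, z, hxyz, h⟩ := (testBit_cornerNbrs _).1 hbit
      have := hxyz.lt
      obtain ⟨rfl, rfl⟩ : a = x ∧ b = y := by omega
      exact ⟨hx, _, Or.inr hxyz⟩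
    | cons t l ih =>
      exact hT.soundNbrs_addNbrs (ih fun t ht => hl t (List.mem_cons_of_mem _ ht))
        (hl t List.mem_cons_self)
  · clear h hl
    induction l with
    | nil => exact fun a ha b c h => (testBit_corners _).2 ⟨a, ha, b, c, h, rfl⟩
    | cons t l ih =>
      intro a ha b c h
      rw [List.foldr_cons, addTri, testBit_lor]
      exact Or.inl (ih a ha b c h)

end Labelling

end Soundness

/-! ### Running the search -/

section Acceptance

/-- Lists of labels of the vertices `0, …, 11` of a model. The choice of a vertex of a model, to be
labelled `0`, and of a direction around it determines the labels up to the exchanges of `4` with `10`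
and of `5` with `11`; the automorphism groups of the models have orders `2`, `2` and `3`, which leaves
`12 + 12 + 8` labellings. -/
def relabellings : List (Fin 3 × List ℕ) := [
  (0, [0, 1, 3, 6, 9, 5, 2, 4, 8, 11, 10, 7]), (0, [0, 5, 9, 6, 3, 1, 4, 2, 10, 7, 8, 11]),
  (0, [1, 3, 4, 7, 10, 5, 2, 0, 8, 11, 6, 9]), (0, [1, 5, 4, 7, 10, 3, 0, 2, 6, 9, 8, 11]),
  (0, [1, 5, 10, 7, 4, 0, 3, 8, 9, 6, 2, 11]), (0, [3, 11, 6, 9, 0, 1, 4, 8, 10, 7, 2, 5]),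
  (0, [5, 9, 2, 11, 8, 10, 7, 0, 1, 4, 6, 3]), (0, [6, 7, 9, 0, 3, 8, 5, 10, 11, 2, 4, 1]),
  (0, [6, 11, 3, 0, 9, 10, 1, 8, 7, 4, 2, 5]), (0, [7, 9, 10, 1, 4, 8, 11, 6, 5, 2, 0, 3]),
  (0, [7, 11, 4, 1, 10, 9, 0, 2, 6, 3, 8, 5]), (0, [7, 11, 10, 1, 4, 6, 3, 8, 9, 0, 2, 5]),
  (1, [0, 1, 3, 6, 9, 7, 5, 2, 4, 8, 11, 10]), (1, [1, 2, 10, 7, 4, 8, 3, 0, 11, 6, 9, 5]),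
  (1, [2, 0, 5, 8, 11, 6, 10, 1, 9, 7, 4, 3]), (1, [3, 1, 0, 9, 6, 7, 5, 8, 4, 2, 11, 10]),
  (1, [4, 5, 7, 10, 1, 11, 9, 0, 8, 6, 3, 2]), (1, [5, 0, 2, 11, 8, 6, 4, 7, 3, 1, 10, 9]),
  (1, [6, 4, 3, 0, 9, 10, 11, 8, 1, 2, 5, 7]), (1, [7, 5, 4, 1, 10, 11, 9, 6, 2, 0, 3, 8]),
  (1, [8, 3, 5, 2, 11, 9, 4, 7, 0, 1, 10, 6]), (1, [9, 4, 0, 3, 6, 10, 2, 11, 1, 5, 8, 7]),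
  (1, [10, 2, 1, 4, 7, 8, 3, 6, 5, 0, 9, 11]), (1, [11, 3, 8, 5, 2, 9, 10, 1, 6, 7, 4, 0]),
  (2, [0, 1, 3, 6, 9, 7, 5, 2, 4, 8, 11, 10]), (2, [0, 7, 9, 6, 3, 1, 2, 5, 10, 11, 8, 4]),
  (2, [1, 8, 4, 7, 10, 2, 0, 3, 5, 9, 6, 11]), (2, [2, 6, 11, 8, 5, 0, 1, 4, 3, 10, 7, 9]),
  (2, [3, 7, 6, 9, 0, 1, 8, 11, 10, 5, 2, 4]), (2, [4, 11, 1, 10, 7, 5, 0, 9, 2, 3, 6, 8]),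
  (2, [5, 6, 8, 11, 2, 0, 7, 10, 9, 4, 1, 3]), (2, [8, 9, 11, 2, 5, 3, 7, 10, 6, 4, 1, 0])]

/-- Exchanges the labels `m` and `n`. -/
def exchange (m n x : ℕ) : ℕ := bif Nat.beq x m then n else bif Nat.beq x n then m else x

/-- The relabelling `p` maps the listed face to a quadrangle of the standard labelling, or to a
triangle recorded in the table `M`. -/
def mapsFace (M : ℕ) (p : Fin 12 → ℕ) : List (Fin 12) → Bool
  | [a, b, c] => (row M (p a) (p b)).testBit (p c) && !Nat.beq (opposite (p b)) (p c)
  | [a, b, c, d] => Nat.beq (opposite (p a)) (p c) && Nat.beq (opposite (p b)) (p d) &&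
      (Nat.beq (p b) ((p a + 3) % 12) || Nat.beq (p b) ((p a + 9) % 12))
  | _ => false

/-- The relabelling `p` of the vertices of the model `i` is a bijection that maps all faces to
quadrangles of the standard labelling and triangles recorded in `M`. -/
def embeds (M : ℕ) (i : Fin 3) (p : Fin 12 → ℕ) : Bool :=
  (modelFaces i).all (mapsFace M p) && decide (∀ j, p j < 12) && decide (∀ n : Fin 12, ∃ j, p j = n)

/-- The table `M` contains a relabelled model. -/
def accept (M : ℕ) : Bool :=
  relabellings.any fun t => [id, exchange 4 10, exchange 5 11, exchange 4 10 ∘ exchange 5 11].any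
    fun s => embeds M t.1 fun j => s (t.2.getD j 0)

theorem searchFrom₁ : searchFrom accept [(0, 3, 1), (0, 1, 2)] = true := by decide +kernel

theorem searchFrom₂ : searchFrom accept [(0, 3, 1), (0, 1, 4), (0, 4, 2)] = true := by
  decide +kernel

theorem searchFrom₃ : searchFrom accept [(0, 3, 1), (0, 1, 4), (0, 4, 7), (0, 7, 2)] = true := by
  decide +kernel

theorem searchFrom₄ :
    searchFrom accept [(0, 3, 1), (0, 1, 4), (0, 4, 7), (0, 7, 10), (0, 10, 9)] = true := by
  decide +kernel

end Acceptance

/-! ### Choosing the labels -/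

section Frames

variable {V : Type*} [DecidableEq V] {K : Finset (Finset (Sym2 V))}

/-- A labelling of the vertices by `0, …, 11` in which the quadrangles are `a, a + 3, a + 6, a + 9`
modulo `12`. -/
structure IsFrame (K : Finset (Finset (Sym2 V))) (σ : ℕ → V) : Prop where
  injOn : ∀ i < 12, ∀ j < 12, σ i = σ j → i = j
  surj : ∀ v, ∃ i < 12, σ i = v
  quad : ∀ a < 12, Quad K (σ a) (σ ((a + 3) % 12)) (σ ((a + 6) % 12)) (σ ((a + 9) % 12))

/-- The labels of a triangle of `K`. -/
def LabelTri (K : Finset (Finset (Sym2 V))) (σ : ℕ → V) (a b c : ℕ) : Prop :=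
  a < 12 ∧ b < 12 ∧ c < 12 ∧ Tri K (σ a) (σ b) (σ c)

theorem Tri.ne {a b c : V} (h : Tri K a b c) : a ≠ b := by
  have := h.1; simp at this; tauto

theorem IsFrame.labelling {σ : ℕ → V} (hσ : IsFrame K σ) (hK : ∀ x, ∃ w d, Star K x w d) :
    Labelling (LabelTri K σ) where
  swap_left := fun ⟨ha, hb, hc, h⟩ => ⟨hb, ha, hc, h.swap_left⟩
  swap_right := fun ⟨ha, hb, hc, h⟩ => ⟨ha, hc, hb, h.swap_right⟩
  lt := fun h => h.1
  ne := fun h hab => h.2.2.2.ne (by rw [hab])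
  ne_opposite := by
    rintro a b c ⟨ha, hb, hc, h⟩ hab
    obtain ⟨w, d, hs⟩ := hK (σ a)
    refine hs.opposite_not_link (hσ.quad a ha) (σ c) ?_
    rw [hab]
    exact h.link
  link := by
    intro a ha
    obtain ⟨w, d, hs⟩ := hK (σ a)
    choose n hn hσn using fun i => hσ.surj (w i)
    have hb3 : (a + 3) % 12 < 12 := Nat.mod_lt _ (by norm_num)
    have hb9 : (a + 9) % 12 < 12 := Nat.mod_lt _ (by norm_num)
    have hfwd : ∀ b c, b < 12 → c < 12 → Link K (σ a) (σ b) (σ c) →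
        ∃ i, b = n i ∧ c = n (i + 1) ∨ c = n i ∧ b = n (i + 1) := by
      intro b c hb hc h
      obtain ⟨i, h⟩ := hs.link_iff.1 h
      simp only [← hσn] at h
      refine ⟨i, h.imp ?_ ?_⟩
      · exact fun h => ⟨hσ.injOn _ hb _ (hn _) h.1, hσ.injOn _ hc _ (hn _) h.2⟩
      · exact fun h => ⟨hσ.injOn _ hc _ (hn _) h.1, hσ.injOn _ hb _ (hn _) h.2⟩
    have hbwd : ∀ b c, b < 12 → c < 12 → Link K (σ a) (σ b) (σ c) →
        LabelTri K σ a b c ∨ Corner a b c := by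
      rintro b c hb hc (h | ⟨e, h⟩)
      · exact Or.inl ⟨ha, hb, hc, h⟩
      · right
        have h₁ := (hs.quad_unique h).2
        have h₂ := (hs.quad_unique (hσ.quad a ha)).2
        rcases h₁ with h₁ | h₁ <;> rcases h₂ with h₂ | h₂
        · exact Or.inl ⟨hσ.injOn _ hb _ hb3 (h₁.1.trans h₂.1.symm),
            hσ.injOn _ hc _ hb9 (h₁.2.trans h₂.2.symm)⟩
        · exact Or.inr ⟨hσ.injOn _ hb _ hb9 (h₁.1.trans h₂.2.symm),
            hσ.injOn _ hc _ hb3 (h₁.2.trans h₂.1.symm)⟩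
        · exact Or.inr ⟨hσ.injOn _ hb _ hb9 (h₁.1.trans h₂.2.symm),
            hσ.injOn _ hc _ hb3 (h₁.2.trans h₂.1.symm)⟩
        · exact Or.inl ⟨hσ.injOn _ hb _ hb3 (h₁.1.trans h₂.1.symm),
            hσ.injOn _ hc _ hb9 (h₁.2.trans h₂.2.symm)⟩
    refine ⟨n, fun i j hij => hs.injective
      ((hσn i).symm.trans ((congrArg σ hij).trans (hσn j))), fun b c => ⟨?_, ?_⟩⟩
    · rintro (⟨-, hb, hc, h⟩ | ⟨rfl, rfl⟩ | ⟨rfl, rfl⟩)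
      · exact hfwd b c hb hc h.link
      · exact hfwd _ _ hb3 hb9 (hσ.quad a ha).link
      · exact hfwd _ _ hb9 hb3 (hσ.quad a ha).reflect.link
    · rintro ⟨i, ⟨rfl, rfl⟩ | ⟨rfl, rfl⟩⟩
      · exact hbwd _ _ (hn _) (hn _) (hs.link_iff.2 ⟨i, Or.inl ⟨hσn _, hσn _⟩⟩)
      · exact hbwd _ _ (hn _) (hn _) (hs.link_iff.2 ⟨i, Or.inr ⟨hσn _, hσn _⟩⟩)

variable {a₀ a₁ a₂ a₃ b₀ b₁ b₂ b₃ c₀ c₁ c₂ c₃ : V}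

theorem Quad.exists_of_mem (h : Quad K a₀ a₁ a₂ a₃) {v : V} (hv : v ∈ [a₀, a₁, a₂, a₃]) :
    ∃ p q r, Quad K v p q r ∧ ∀ u, u ∈ [v, p, q, r] ↔ u ∈ [a₀, a₁, a₂, a₃] := by
  simp only [List.mem_cons, List.not_mem_nil, or_false] at hv ⊢
  rcases hv with rfl | rfl | rfl | rfl
  · exact ⟨_, _, _, h, by tauto⟩
  · exact ⟨_, _, _, h.rotate, by tauto⟩
  · exact ⟨_, _, _, h.rotate.rotate, by tauto⟩
  · exact ⟨_, _, _, h.rotate.rotate.rotate, by tauto⟩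

/-- Distinct quadrangles have no common vertex. -/
theorem Quad.mem_of_mem (hK : ∀ x, ∃ w d, Star K x w d) (hA : Quad K a₀ a₁ a₂ a₃)
    (hB : Quad K b₀ b₁ b₂ b₃) {v : V} (ha : v ∈ [a₀, a₁, a₂, a₃]) (hb : v ∈ [b₀, b₁, b₂, b₃]) :
    b₀ ∈ [a₀, a₁, a₂, a₃] := by
  obtain ⟨p, q, r, h₁, h₁'⟩ := hA.exists_of_mem ha
  obtain ⟨p', q', r', h₂, h₂'⟩ := hB.exists_of_mem hb
  obtain ⟨w, d, hs⟩ := hK v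
  have e₁ := hs.quad_unique h₁
  have e₂ := hs.quad_unique h₂
  have hb₀ : b₀ ∈ [v, p', q', r'] := (h₂' b₀).2 (by simp)
  rw [← h₁']
  simp only [List.mem_cons, List.not_mem_nil, or_false] at hb₀ ⊢
  grind

theorem exists_frame [Fintype V] (hK : ∀ x, ∃ w d, Star K x w d) (hcard : Fintype.card V = 12)
    (hA : Quad K a₀ a₁ a₂ a₃) (hB : Quad K b₀ b₁ b₂ b₃) (hC : Quad K c₀ c₁ c₂ c₃)
    (hAB : b₀ ∉ [a₀, a₁, a₂, a₃]) (hAC : c₀ ∉ [a₀, a₁, a₂, a₃]) (hBC : c₀ ∉ [b₀, b₁, b₂, b₃]) :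
    IsFrame K fun n => [a₀, b₀, c₀, a₁, b₁, c₁, a₂, b₂, c₂, a₃, b₃, c₃].getD n a₀ := by
  have hAB' : ∀ v ∈ [a₀, a₁, a₂, a₃], v ∉ [b₀, b₁, b₂, b₃] :=
    fun v ha hb => hAB (hA.mem_of_mem hK hB ha hb)
  have hAC' : ∀ v ∈ [a₀, a₁, a₂, a₃], v ∉ [c₀, c₁, c₂, c₃] :=
    fun v ha hc => hAC (hA.mem_of_mem hK hC ha hc)
  have hBC' : ∀ v ∈ [b₀, b₁, b₂, b₃], v ∉ [c₀, c₁, c₂, c₃] :=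
    fun v hb hc => hBC (hB.mem_of_mem hK hC hb hc)
  have hnd : [a₀, b₀, c₀, a₁, b₁, c₁, a₂, b₂, c₂, a₃, b₃, c₃].Nodup := by
    -- Sorted by quadrangles, the list is free of repetitions because the quadrangles are disjoint.
    have hperm : [a₀, b₀, c₀, a₁, b₁, c₁, a₂, b₂, c₂, a₃, b₃, c₃].Perm
        ([a₀, a₁, a₂, a₃] ++ ([b₀, b₁, b₂, b₃] ++ [c₀, c₁, c₂, c₃])) := by
      rw [List.perm_iff_count]
      intro v
      simp only [List.cons_append, List.nil_append, List.count_cons, List.count_nil]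
      omega
    rw [hperm.nodup_iff, List.nodup_append', List.nodup_append']
    refine ⟨hA.1, ⟨hB.1, hC.1, hBC'⟩, fun v hv hv' => ?_⟩
    rcases List.mem_append.1 hv' with h | h
    exacts [hAB' v hv h, hAC' v hv h]
  have hlen : [a₀, b₀, c₀, a₁, b₁, c₁, a₂, b₂, c₂, a₃, b₃, c₃].length = 12 := rfl
  refine ⟨fun i hi j hj hij => ?_, fun v => ?_, fun a ha => ?_⟩
  · rw [List.getD_eq_getElem _ _ (by omega), List.getD_eq_getElem _ _ (by omega)] at hij
    exact hnd.getElem_inj_iff.1 hij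
  · have huniv := Finset.eq_univ_of_card _ ((List.toFinset_card_of_nodup hnd).trans
      (hlen.trans hcard.symm))
    have hv : v ∈ [a₀, b₀, c₀, a₁, b₁, c₁, a₂, b₂, c₂, a₃, b₃, c₃] := by
      rw [← List.mem_toFinset, huniv]; exact Finset.mem_univ v
    obtain ⟨i, hi, rfl⟩ := List.getElem_of_mem hv
    exact ⟨i, hi, List.getD_eq_getElem _ _ hi⟩
  · interval_cases a
    exacts [hA, hB, hC, hA.rotate, hB.rotate, hC.rotate, hA.rotate.rotate, hB.rotate.rotate,
      hC.rotate.rotate, hA.rotate.rotate.rotate, hB.rotate.rotate.rotate, hC.rotate.rotate.rotate]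

/-- The labels can be chosen such that the triangles at the vertex `0` begin in one of four ways,
according to which vertices of the link of `0` lie on the quadrangle through `1`. -/
theorem exists_frame_start [Fintype V] (hK : ∀ x, ∃ w d, Star K x w d)
    (hcard : Fintype.card V = 12) : ∃ σ, IsFrame K σ ∧
      ∃ l ∈ [[(0, 3, 1), (0, 1, 2)], [(0, 3, 1), (0, 1, 4), (0, 4, 2)],
        [(0, 3, 1), (0, 1, 4), (0, 4, 7), (0, 7, 2)],
        [(0, 3, 1), (0, 1, 4), (0, 4, 7), (0, 7, 10), (0, 10, 9)]],
        ∀ t ∈ l, LabelTri K σ t.1 t.2.1 t.2.2 := by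
  have hquad : ∀ x, ∃ p q r, Quad K x p q r := fun x => by
    obtain ⟨w, d, hs⟩ := hK x
    exact ⟨_, _, _, hs.quad⟩
  obtain ⟨x⟩ : Nonempty V := Fintype.card_pos_iff.1 (by omega)
  obtain ⟨w, d, hs⟩ := hK x
  have hA := hs.quad.reflect
  have hwA : ∀ i, i ≠ 0 → i ≠ 5 → w i ∉ [x, w 0, d, w 5] := by
    intro i h0 h5
    simp only [List.mem_cons, List.not_mem_nil, or_false, hs.injective.eq_iff, h0, h5,
      (hs.ne i).symm, (hs.opposite_ne i).symm, not_false_eq_true]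
  have t₀ : Tri K x (w 0) (w 1) := hs.tri 0 (by decide)
  have t₁ : Tri K x (w 1) (w 2) := hs.tri 1 (by decide)
  have t₂ : Tri K x (w 2) (w 3) := hs.tri 2 (by decide)
  have t₃ : Tri K x (w 3) (w 4) := hs.tri 3 (by decide)
  have t₄ : Tri K x (w 4) (w 5) := hs.tri 4 (by decide)
  have hopp : ∀ {a b c e f}, Quad K a b c e → ¬ Tri K f a c := fun {a b c e f} hq ht => by
    obtain ⟨w, d, hs⟩ := hK a
    exact hs.opposite_not_link hq f ht.swap_left.swap_right.link
  have h1A := hwA 1 (by decide) (by decide)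
  have h2A := hwA 2 (by decide) (by decide)
  have h3A := hwA 3 (by decide) (by decide)
  have h4A := hwA 4 (by decide) (by decide)
  -- The vertices `w 1, w 2, …` follow the quadrangle through `w 1` for some time; the first vertex
  -- to leave it receives the label `2`.
  obtain ⟨e, f, g, hB⟩ := hquad (w 1)
  by_cases h2 : w 2 ∈ [w 1, e, f, g]
  swap
  · obtain ⟨p, q, r, hC⟩ := hquad (w 2)
    refine ⟨_, exists_frame hK hcard hA hB hC h1A h2A h2, _, List.mem_cons_self, ?_⟩
    simpa [LabelTri] using ⟨t₀, t₁⟩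
  obtain ⟨f, g, hB⟩ : ∃ f g, Quad K (w 1) (w 2) f g := by
    simp only [List.mem_cons, List.not_mem_nil, or_false] at h2
    rcases h2 with h2 | h2 | h2 | h2
    · exact absurd (hs.injective h2) (by decide)
    · exact ⟨f, g, h2 ▸ hB⟩
    · exact absurd (h2 ▸ t₁) (hopp hB)
    · exact ⟨f, e, h2 ▸ hB.reflect⟩
  by_cases h3 : w 3 ∈ [w 1, w 2, f, g]
  swap
  · obtain ⟨p, q, r, hC⟩ := hquad (w 3)
    refine ⟨_, exists_frame hK hcard hA hB hC h1A h3A h3, _,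
      List.mem_cons_of_mem _ List.mem_cons_self, ?_⟩
    simpa [LabelTri] using ⟨t₀, t₁, t₂⟩
  obtain rfl : w 3 = f := by
    simp only [List.mem_cons, List.not_mem_nil, or_false] at h3
    rcases h3 with h3 | h3 | h3 | h3
    · exact absurd (hs.injective h3) (by decide)
    · exact absurd (hs.injective h3) (by decide)
    · exact h3
    · exact absurd (h3 ▸ t₂) (hopp hB.rotate)
  by_cases h4 : w 4 ∈ [w 1, w 2, w 3, g]
  swap
  · obtain ⟨p, q, r, hC⟩ := hquad (w 4)
    refine ⟨_, exists_frame hK hcard hA hB hC h1A h4A h4, _,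
      List.mem_cons_of_mem _ (List.mem_cons_of_mem _ List.mem_cons_self), ?_⟩
    simpa [LabelTri] using ⟨t₀, t₁, t₂, t₃⟩
  obtain rfl : w 4 = g := by
    simp only [List.mem_cons, List.not_mem_nil, or_false, hs.injective.eq_iff] at h4
    rcases h4 with h4 | h4 | h4 | h4
    exacts [absurd h4 (by decide), absurd h4 (by decide), absurd h4 (by decide), h4]
  obtain ⟨c, hc⟩ : ∃ c, c ∉ ([x, w 0, d, w 5] ++ [w 1, w 2, w 3, w 4]).toFinset := by
    by_contra! h
    have h₁ := List.toFinset_card_le ([x, w 0, d, w 5] ++ [w 1, w 2, w 3, w 4])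
    rw [Finset.eq_univ_iff_forall.2 h, Finset.card_univ, hcard] at h₁
    simp at h₁
  rw [List.mem_toFinset, List.mem_append, not_or] at hc
  obtain ⟨p, q, r, hC⟩ := hquad c
  refine ⟨_, exists_frame hK hcard hA hB hC h1A hc.1 hc.2, _, List.mem_cons_of_mem _
    (List.mem_cons_of_mem _ (List.mem_cons_of_mem _ List.mem_cons_self)), ?_⟩
  simpa [LabelTri] using ⟨t₀, t₁, t₂, t₃, t₄⟩

end Frames

/-! ### The classification -/

section Classification

theorem card_model (i : Fin 3) : (model i).card = 23 := by
  have := (isSemiEquivelarMap_model i).card_faces_edges.1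
  rw [Fintype.card_fin] at this
  omega

variable {V : Type*} [DecidableEq V] {K : Finset (Finset (Sym2 V))}

theorem polygon_map {W : Type*} [DecidableEq W] (f : W ↪ V) (l : List W) :
    polygon (l.map f) = (polygon l).map f.sym2Map := by
  have : List.zipWith (fun a b => s(a, b)) (l.map f) ((l.map f).rotate 1) =
      (List.zipWith (fun a b => s(a, b)) l (l.rotate 1)).map (Sym2.map f) := by
    rw [← List.map_rotate, List.map_zipWith, List.zipWith_map]
    rfl
  ext e
  rw [polygon, this]
  simp only [polygon, List.mem_toFinset, Finset.mem_map, List.mem_map]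
  rfl

/-- A bijection that maps all faces of `L` to faces of `K` is an isomorphism if `K` does not have
more faces than `L`. -/
theorem isomorphic_of_forall_mem {W : Type*} [DecidableEq W] {L : Finset (Finset (Sym2 W))}
    (g : W ≃ V) (h : ∀ C ∈ L, C.map g.toEmbedding.sym2Map ∈ K) (hcard : K.card ≤ L.card) :
    Isomorphic K L := by
  have hgf : ∀ C : Finset (Sym2 W),
      (C.map g.toEmbedding.sym2Map).map g.symm.toEmbedding.sym2Map = C := by
    intro C
    rw [Finset.map_map]
    convert Finset.map_refl
    ext e
    induction e with | h a b => simp [Function.Embedding.sym2Map]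
  have hfg : ∀ C : Finset (Sym2 V),
      (C.map g.symm.toEmbedding.sym2Map).map g.toEmbedding.sym2Map = C := by
    intro C
    rw [Finset.map_map]
    convert Finset.map_refl
    ext e
    induction e with | h a b => simp [Function.Embedding.sym2Map]
  have himage : L.image (fun C => C.map g.toEmbedding.sym2Map) = K := by
    refine Finset.eq_of_subset_of_card_le (fun C hC => ?_) ?_
    · obtain ⟨D, hD, rfl⟩ := Finset.mem_image.1 hC
      exact h D hD
    · rwa [Finset.card_image_of_injective _ fun C D hCD => by
        rw [← hgf C, ← hgf D]; exact congrArg _ hCD]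
  refine ⟨g.symm, fun C => ⟨fun hC => ?_, fun hC => ?_⟩⟩
  · rw [← himage] at hC
    obtain ⟨D, hD, rfl⟩ := Finset.mem_image.1 hC
    rwa [hgf]
  · rw [← hfg C]
    exact h _ hC

/-- A table of edges of links into which a model embeds determines an isomorphism. -/
theorem IsFrame.isomorphic_of_embeds {σ : ℕ → V} (hσ : IsFrame K σ) (hK : K.card = 23) {M : ℕ}
    (hM : Sound (LabelTri K σ) M) {i : Fin 3} {p : Fin 12 → ℕ} (h : embeds M i p = true) :
    Isomorphic K (model i) := by
  simp only [embeds, Bool.and_eq_true, List.all_eq_true, decide_eq_true_eq] at h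
  obtain ⟨⟨hface, hp⟩, hsurj⟩ := h
  have hbij : Function.Bijective fun j => σ (p j) := by
    have hs : Function.Surjective fun j => (⟨p j, hp j⟩ : Fin 12) := fun n => by
      obtain ⟨j, hj⟩ := hsurj n
      exact ⟨j, Fin.ext hj⟩
    have hinj := Finite.injective_iff_surjective.2 hs
    constructor
    · intro j k hjk
      exact hinj (Fin.ext (hσ.injOn _ (hp j) _ (hp k) hjk))
    · intro v
      obtain ⟨n, hn, rfl⟩ := hσ.surj v
      obtain ⟨j, hj⟩ := hsurj ⟨n, hn⟩
      exact ⟨j, congrArg σ hj⟩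
  let g : Fin 12 ≃ V := Equiv.ofBijective _ hbij
  refine isomorphic_of_forall_mem g ?_ (by rw [hK, card_model])
  intro C hC
  obtain ⟨l, hl, rfl⟩ := mem_model.1 hC
  rw [← polygon_map]
  have hl := hface l hl
  unfold mapsFace at hl
  split at hl
  · rename_i a b c _
    simp only [Bool.and_eq_true, Bool.not_eq_true', testBit_row, natBeq_eq_false] at hl
    obtain ⟨⟨-, hbit⟩, hopp⟩ := hl
    rcases (hM _ _ _ (hp b) (hp c) hbit).2 with h | h
    · exact h.2.2.2.2
    · refine absurd ?_ hopp
      change (p b + 6) % 12 = p c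
      unfold Corner at h; omega
  · rename_i a b c d _
    simp only [Bool.and_eq_true, Bool.or_eq_true, Nat.beq_eq] at hl
    obtain ⟨⟨hac, hbd⟩, hab⟩ := hl
    change (p a + 6) % 12 = p c at hac
    change (p b + 6) % 12 = p d at hbd
    have hq := hσ.quad (p a) (hp a)
    rw [hac] at hq
    rcases hab with hab | hab
    · rw [← hab, show (p a + 9) % 12 = p d by omega] at hq
      exact hq.2
    · rw [← hab, show (p a + 3) % 12 = p d by omega] at hq
      exact hq.reflect.2
  · exact absurd hl (by simp)

/-- A semi-equivelar map of type `(3⁵, 4)` and Euler characteristic `-1` is one of the models. -/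
theorem IsSemiEquivelarMap.isomorphic [Fintype V]
    (hK : IsSemiEquivelarMap K [3, 3, 3, 3, 3, 4]) (hχ : eulerChar K = -1) :
    Fintype.card V = 12 ∧ ∃ i, Isomorphic K (model i) := by
  have hV : Fintype.card V = 12 := by
    have := hK.eulerChar_mul
    omega
  have hF : K.card = 23 := by
    have := hK.card_faces_edges.1
    omega
  obtain ⟨σ, hσ, l, hl, hstart⟩ := exists_frame_start hK.exists_star hV
  have hrun : searchFrom accept l = true := by
    simp only [List.mem_cons, List.not_mem_nil, or_false] at hl
    rcases hl with rfl | rfl | rfl | rfl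
    exacts [searchFrom₁, searchFrom₂, searchFrom₃, searchFrom₄]
  obtain ⟨M, hM, hacc⟩ :=
    (hσ.labelling hK.exists_star).exists_accept_of_searchFrom hstart hrun
  simp only [accept, List.any_eq_true] at hacc
  obtain ⟨t, -, s, -, h⟩ := hacc
  exact ⟨hV, t.1, hσ.isomorphic_of_embeds hF hM h⟩

end Classification

end SemiEquivelar

theorem theorem1 :
    -- the three models are semi-equivelar maps of type (3⁵, 4) with Euler characteristic -1
    (∀ i, SemiEquivelar.IsSemiEquivelarMap (SemiEquivelar.model i) [3, 3, 3, 3, 3, 4] ∧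
      SemiEquivelar.eulerChar (SemiEquivelar.model i) = -1) ∧
    -- every such map has 12 vertices and is isomorphic to one of the models
    (∀ (V : Type*) [Fintype V] [DecidableEq V] (K : Finset (Finset (Sym2 V))),
      SemiEquivelar.IsSemiEquivelarMap K [3, 3, 3, 3, 3, 4] →
      SemiEquivelar.eulerChar K = -1 →
      Fintype.card V = 12 ∧
      (SemiEquivelar.Isomorphic K SemiEquivelar.K₁ ∨ SemiEquivelar.Isomorphic K SemiEquivelar.K₂ ∨
        SemiEquivelar.Isomorphic K SemiEquivelar.K₃)) ∧
    -- the models are pairwise non-isomorphic, and this is detected by the graphs `G_t`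
    (∀ i j, i ≠ j →
      ¬ SemiEquivelar.Isomorphic (SemiEquivelar.model i) (SemiEquivelar.model j) ∧
      ∃ t : ℕ, t ≤ 12 ∧ IsEmpty (SemiEquivelar.commonGraph (SemiEquivelar.model i) t ≃g
        SemiEquivelar.commonGraph (SemiEquivelar.model j) t)) ∧
    -- none of the models is vertex-transitive, and this is detected by the graphs `G_t`
    (∀ i, ¬ SemiEquivelar.IsVertexTransitive (SemiEquivelar.model i) ∧
      ∃ t : ℕ, t ≤ 12 ∧ ∃ x y : Fin 12,
        ∀ g : SemiEquivelar.commonGraph (SemiEquivelar.model i) t ≃g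
          SemiEquivelar.commonGraph (SemiEquivelar.model i) t, g x ≠ y) := by
  refine ⟨fun i => ⟨SemiEquivelar.isSemiEquivelarMap_model i, SemiEquivelar.eulerChar_model i⟩,
    fun V _ _ K hK hχ => ?_, fun i j hij => ?_, fun i => ?_⟩
  · obtain ⟨hV, i, hi⟩ := hK.isomorphic hχ
    refine ⟨hV, ?_⟩
    fin_cases i
    exacts [Or.inl hi, Or.inr (Or.inl hi), Or.inr (Or.inr hi)]
  · have h := SemiEquivelar.isEmpty_commonGraph_iso hij
    exact ⟨fun ⟨_, hf⟩ => h.false (hf.commonGraphIso 4), 4, by norm_num, h⟩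
  · obtain ⟨x, y, hxy⟩ := SemiEquivelar.degree_commonGraph_model i
    have h : ∀ g : SemiEquivelar.commonGraph (SemiEquivelar.model i) 4 ≃g
        SemiEquivelar.commonGraph (SemiEquivelar.model i) 4, g x ≠ y := fun g hg =>
      hxy (by rw [← hg, g.degree_eq])
    refine ⟨fun ht => ?_, 4, by norm_num, x, y, h⟩
    obtain ⟨f, hf, hfx⟩ := ht x y
    exact h (hf.commonGraphIso 4) hfx
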